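/- **Setting.** Let $X$ be a closed subset of a separable Banach space with the induced metric $d_X$, $Y$ a complete separable metric space, $\mathcal H$ a separable real Hilbert space. Let $F\colon X\rightsquigarrow Y$ be a set-valued function with closed graph $Z=\{(x,y): y\in F(x)\}$ and non-empty images $Z_x=F(x)$, and let $g\colon Z\to\mathcal H$, $f\colon\mathcal H\to\mathbb R$. For $\lambda\in\mathcal H$ put $g_\lambda=\langle\lambda,g\rangle$, $G_\lambda(x)=\{g_\lambda(x,y):y\in Z_x\}$ and $\mathbf{BR}_\lambda(x)=\operatorname{argmin}_{y\in Z_x}g_\lambda(x,y)$. Assume: 1. $g$ is bounded; $f$ is convex and differentiable, and $\nabla f$ is $L$-Lipschitz; for every $\lambda\in\nabla f(\mathcal H)$ the function $g_\lambda$ and the set-valued function $G_\lambda$ are lower semicontinuous and $\mathbf{BR}_\lambda$ has non-empty images. 2. $g$ is continuous; every $Z_x$ is compact and $F$ is upper semicontinuous; there is $L_g\ge 0$ such that $\mathcal Z(x)=\{g(x,y):y\in Z_x\}$ is $L_g$-Lipschitz, i.e. $\mathcal Z(x_1)\subseteq \mathcal Z(x_2)+\bar B(0,L_g d_X(x_1,x_2))$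 for all $x_1,x_2\in X$. Let $M=\sup_{Z}\|g\|$, $D=\sup_{z_1,z_2\in Z}\|g(z_1)-g(z_2)\|^2$, $C=\sup_{\mu\in\mathcal P(Z)}\|\nabla f(\int_Z g\,d\mu)\|$. For a Borel probability measure $m$ on $X$ let $\mathcal P_m(Z)$ be the set of Borel probability measures on $Z$ with first marginal $m$, and $\mathrm{val}(P_m)=\inf_{\mu\in\mathcal P_m(Z)}f(\int_Z g\,d\mu)$. Let $d_1(m_0,m_1)=\sup\{\int\varphi\,d m_0-\int\varphi\,d m_1:\varphi\colon X\to\mathbb R\ \text{1-Lipschitz}\}$. **Stochastic Frank–Wolfe (SFW).** Let $x_1,\dots,x_N\in X$ and $m_N=\frac1N\sum_i\delta_{x_i}$. Start from $y^0\in\prod_iZ_{x_i}$. At iteration $k=0,\dots,K-1$ let $\lambda^k=\nabla f(\frac1N\sum_i g(x_i,y_i^k))$, choose $\bar y_i^k\in\mathbf{BR}_{\lambda^k}(x_i)$ for each $i$, and let $n_k\ge1$ be an arbitrary number of simulations. For $j=1,\dots,n_k$ and $i=1,\dots,N$ draw $P_i^{k,j}\sim\mathrm{Bern}(2/(k+2))$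 independently of all previously defined random variables, and set $\hat y_i^{k,j}=\bar y_i^k$ if $P_i^{k,j}=1$, $\hat y^{k,j}_i=y_i^k$ otherwise. Then $y^{k+1}$ is a minimizer of $y\mapsto f(\frac1N\sum_i g(x_i,y_i))$ over $\{\hat y^{k,j}:1\le j\le n_k\}$. **Bridging method.** Given $m_0,m_1$ with finite first moment and $\bar\mu_0\in\mathcal P_{m_0}(Z)$: take a minimizer $\rho$ of $\int d_X(x,x')\,d\rho$ over the couplings of $m_0$ and $m_1$; take a probability measure $\nu$ on $Z\times X$ whose $(x,y)$-marginal is $\bar\mu_0$ and whose $(x,x')$-marginal is $\rho$; take a Borel map $s\colon Z\times X\to Z$ with $s(x,y,x')\in\{(x',y')\in Z:\|g(x',y')-g(x,y)\|\le L_g d_X(x,x')\}$; the output is $s_\#\nu$. **Theorem.** Let $m$ be a Borel probability measure on $X$ with finite first moment, let $1\le K\le 2N$, and let $y^K$ be the outcome of $K$ iterations of SFW. Then the bridging method can be applied to $m_0=m_N$, $m_1=m$ and $\bar\mu_0=\frac1N\sum_i\delta_{(x_i,y_i^K)}$, with an output depending measurably on the random event; every such (random) output $\tilde\mu^K$ belongs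 to $\mathcal P_m(Z)$, $f(\int_Zg\,d\tilde\mu^K)$ is integrable, and $$\mathbb E\Big[f\Big(\int_Z g\,d\tilde\mu^K\Big)\Big]-\mathrm{val}(P_m)\le\frac{4LD}{K}+2L_g(C+LM)\,d_1(m_N,m).$$ -/

import Mathlib

open MeasureTheory ProbabilityTheory
open scoped NNReal ENNReal Pointwise

noncomputable section

namespace MFO

/-! ### Data of the mean field optimization problem -/

section Data

variable {X Y H : Type*}

/-- The graph `Z` of a set-valued function `F`; the fibre `Z_x` is `F x`. -/
def graph (F : X → Set Y) : Set (X × Y) := {p | p.2 ∈ F p.1}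

/-- The point `(x, y)` of the graph, for `y ∈ F x`. -/
def pt (F : X → Set Y) (x : X) (y : F x) : graph F := ⟨(x, (y : Y)), y.2⟩

/-- The set-valued function `x ↦ {g (x, y) | y ∈ Z_x}`. -/
def contributions (F : X → Set Y) (g : graph F → H) (x : X) : Set H :=
  Set.range fun y : F x => g (pt F x y)

/-- A set-valued function is `L`-Lipschitz if `A x₁ ⊆ A x₂ + B(0, L d(x₁, x₂))` (closed ball). -/
def SetLipschitz [PseudoMetricSpace X] [SeminormedAddCommGroup H] (L : ℝ≥0) (A : X → Set H) :
    Prop :=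
  ∀ x₁ x₂, A x₁ ⊆ A x₂ + Metric.closedBall (0 : H) (L * dist x₁ x₂)

variable [NormedAddCommGroup H] [InnerProductSpace ℝ H]

/-- `g_lam (x, y) = ⟨lam, g (x, y)⟩`. -/
def gLin (F : X → Set Y) (g : graph F → H) (lam : H) (z : graph F) : ℝ := inner ℝ lam (g z)

/-- The set-valued function `G_lam (x) = {g_lam (x, y) | y ∈ Z_x}`. -/
def GSet (F : X → Set Y) (g : graph F → H) (lam : H) (x : X) : Set ℝ :=
  Set.range fun y : F x => gLin F g lam (pt F x y)

/-- Best responses: `BR_lam (x) = argmin_{y ∈ Z_x} g_lam (x, y)`. -/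
def BR (F : X → Set Y) (g : graph F → H) (lam : H) (x : X) : Set (F x) :=
  {y | ∀ y' : F x, gLin F g lam (pt F x y) ≤ gLin F g lam (pt F x y')}

/-- Standing data: `F` has closed graph and non-empty images. -/
structure IsData [TopologicalSpace X] [TopologicalSpace Y] (F : X → Set Y) : Prop where
  closed_graph : IsClosed (graph F)
  nonempty : ∀ x, (F x).Nonempty

/-- First set of assumptions: `g` bounded, `f` convex and differentiable with `L`-Lipschitz
gradient, and, for each `lam` in the range of the gradient, `g_lam` and `G_lam` are lower
semicontinuous and `BR_lam` has non-empty images. -/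
structure Assumption1 [TopologicalSpace X] [TopologicalSpace Y] [CompleteSpace H]
    (F : X → Set Y) (g : graph F → H) (f : H → ℝ) (L : ℝ≥0) : Prop where
  bounded : ∃ R : ℝ, ∀ z, ‖g z‖ ≤ R
  convex : ConvexOn ℝ Set.univ f
  differentiable : Differentiable ℝ f
  lipschitz_gradient : LipschitzWith L (gradient f)
  lsc : ∀ lam ∈ Set.range (gradient f), LowerSemicontinuous (gLin F g lam)
  lsc_set : ∀ lam ∈ Set.range (gradient f), LowerHemicontinuous (GSet F g lam)
  br_nonempty : ∀ lam ∈ Set.range (gradient f), ∀ x, (BR F g lam x).Nonempty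

/-- Second set of assumptions (apart from `X` being a closed subset of a separable Banach space):
`g` is continuous, the sets `Z_x` are compact, `F` is upper semicontinuous, and
`x ↦ {g (x, y) | y ∈ Z_x}` is `Lg`-Lipschitz. -/
structure Assumption2 [PseudoMetricSpace X] [TopologicalSpace Y]
    (F : X → Set Y) (g : graph F → H) (Lg : ℝ≥0) : Prop where
  continuous : Continuous g
  compact : ∀ x, IsCompact (F x)
  usc : UpperHemicontinuous F
  lipschitz : SetLipschitz Lg (contributions F g)

/-- `M = sup_z ‖g z‖`. -/
def constM (F : X → Set Y) (g : graph F → H) : ℝ := ⨆ z, ‖g z‖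

/-- `D = sup_{z₁, z₂} ‖g z₁ - g z₂‖²`. -/
def constD (F : X → Set Y) (g : graph F → H) : ℝ :=
  ⨆ p : graph F × graph F, ‖g p.1 - g p.2‖ ^ 2

variable [MeasurableSpace X] [MeasurableSpace Y]

/-- `C = sup_μ ‖∇f (∫ g dμ)‖` over all probability measures `μ` on `Z`. -/
def constC [CompleteSpace H] (F : X → Set Y) (g : graph F → H) (f : H → ℝ) : ℝ :=
  ⨆ μ : ProbabilityMeasure (graph F), ‖gradient f (∫ z, g z ∂(μ : Measure (graph F)))‖

/-- `P_m(Z)`: the probability measures on `Z` with first marginal `m`. -/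
def admissible (F : X → Set Y) (m : Measure X) : Set (Measure (graph F)) :=
  {μ | IsProbabilityMeasure μ ∧ μ.map (fun z => z.1.1) = m}

/-- The value of the problem `inf_{μ ∈ P_m(Z)} f (∫ g dμ)`. -/
def val (F : X → Set Y) (g : graph F → H) (f : H → ℝ) (m : Measure X) : ℝ :=
  ⨅ μ : admissible F m, f (∫ z, g z ∂(μ : Measure (graph F)))

end Data

/-! ### Measures on `X` -/

section Measures

variable {X : Type*} [MetricSpace X] [MeasurableSpace X]

/-- Finite first moment. -/
def HasFirstMoment (m : Measure X) : Prop := ∃ x₀ : X, Integrable (fun x => dist x x₀) m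

/-- The Kantorovich–Rubinstein distance `sup {∫ φ dm₀ - ∫ φ dm₁ | φ is 1-Lipschitz}`. -/
def d1 (m₀ m₁ : Measure X) : ℝ :=
  ⨆ φ : {φ : X → ℝ // LipschitzWith 1 φ}, ((∫ x, φ.1 x ∂m₀) - ∫ x, φ.1 x ∂m₁)

/-- The empirical distribution `(1/N) ∑ᵢ δ_{pᵢ}`. -/
def empirical {α : Type*} [MeasurableSpace α] {N : ℕ} (p : Fin N → α) : Measure α :=
  (N : ℝ≥0∞)⁻¹ • ∑ i, Measure.dirac (p i)

/-- Transport plans between `m₀` and `m₁`. -/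
def plans (m₀ m₁ : Measure X) : Set (Measure (X × X)) :=
  {ρ | IsProbabilityMeasure ρ ∧ ρ.map Prod.fst = m₀ ∧ ρ.map Prod.snd = m₁}

/-- The transport cost `∫ d(x, x') dρ(x, x')`, with values in `[0, ∞]`. -/
def transportCost (ρ : Measure (X × X)) : ℝ≥0∞ := ∫⁻ p, edist p.1 p.2 ∂ρ

/-- `ρ` solves the optimal transport problem between `m₀` and `m₁` for the cost `d`. -/
def IsOptimalPlan (m₀ m₁ : Measure X) (ρ : Measure (X × X)) : Prop :=
  ρ ∈ plans m₀ m₁ ∧ ∀ ρ' ∈ plans m₀ m₁, transportCost ρ ≤ transportCost ρ'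

end Measures

/-! ### The bridging method -/

section Bridging

variable {X Y H : Type*} [MetricSpace X] [MeasurableSpace X] [MeasurableSpace Y]
  [NormedAddCommGroup H] [InnerProductSpace ℝ H]

/-- `S(x, y, x') = {(x', y') ∈ Z | ‖g (x', y') - g (x, y)‖ ≤ Lg d(x, x')}`. -/
def bridgeSet (F : X → Set Y) (g : graph F → H) (Lg : ℝ≥0) (p : graph F × X) : Set (graph F) :=
  {z | z.1.1 = p.2 ∧ ‖g z - g p.1‖ ≤ Lg * dist p.1.1.1 p.2}

/-- `μ₁` is an output of the bridging method with input `m₀`, `m₁`, `μ₀`: there are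
an optimal plan `ρ` between `m₀` and `m₁`, a probability `ν` on `Z × X` whose
`(x, y)`-marginal is `μ₀` and whose `(x, x')`-marginal is `ρ`, and a
measurable selection `s` of `S`, such that `μ₁ = s # ν`. -/
def IsBridgingOutput (F : X → Set Y) (g : graph F → H) (Lg : ℝ≥0)
    (m₀ m₁ : Measure X) (μ₀ μ₁ : Measure (graph F)) : Prop :=
  ∃ ρ : Measure (X × X), IsOptimalPlan m₀ m₁ ρ ∧
  ∃ ν : Measure (graph F × X), IsProbabilityMeasure ν ∧ ν.map Prod.fst = μ₀ ∧
    ν.map (fun p => (p.1.1.1, p.2)) = ρ ∧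
  ∃ s : graph F × X → graph F, Measurable s ∧ (∀ p, s p ∈ bridgeSet F g Lg p) ∧
    μ₁ = ν.map s

end Bridging

/-! ### The stochastic Frank–Wolfe algorithm -/

section SFW

/-- The step size `ω_k = 2 / (k + 2)`. -/
def stepSize (k : ℕ) : unitInterval :=
  ⟨2 / ((k : ℝ) + 2), by positivity, by
    rw [div_le_one (by positivity)]
    linarith [(Nat.cast_nonneg k : (0 : ℝ) ≤ k)]⟩

variable {X Y H Ω : Type*} [NormedAddCommGroup H] [InnerProductSpace ℝ H]

/-- The aggregate `(1/N) ∑ᵢ g (xᵢ, yᵢ)` of a profile `y ∈ ∏ᵢ Z_{xᵢ}`. -/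
def aggregate (F : X → Set Y) (g : graph F → H) {N : ℕ} (x : Fin N → X)
    (y : (i : Fin N) → F (x i)) : H :=
  (N : ℝ)⁻¹ • ∑ i, g (pt F (x i) (y i))

/-- Candidate profile: the `i`-th agent switches from `yᵢ` to `ybarᵢ` if `Pᵢ = 1`. -/
def candidate (F : X → Set Y) {N : ℕ} (x : Fin N → X) (y ybar : (i : Fin N) → F (x i))
    (P : Fin N → Bool) : (i : Fin N) → F (x i) :=
  fun i => if P i then ybar i else y i

/-- The σ-algebra generated by all the random variables defined before the Bernoulli variable
with index `(k, j, i)` is simulated: the iterates and the best responses up to `k`, and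
the Bernoulli variables whose index is lexicographically smaller. -/
@[reducible] def past [MeasurableSpace Y] (F : X → Set Y) {N : ℕ} (x : Fin N → X) (n : ℕ → ℕ)
    (y ybar : ℕ → Ω → (i : Fin N) → F (x i)) (P : (k : ℕ) → Fin (n k) → Fin N → Ω → Bool)
    (k : ℕ) (j : Fin (n k)) (i : Fin N) : MeasurableSpace Ω :=
  (⨆ l : ℕ, ⨆ _ : l ≤ k, MeasurableSpace.comap (y l) inferInstance) ⊔
  (⨆ l : ℕ, ⨆ _ : l ≤ k, MeasurableSpace.comap (ybar l) inferInstance) ⊔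
  (⨆ l : ℕ, ⨆ j' : Fin (n l), ⨆ i' : Fin N,
    ⨆ _ : l < k ∨ (l = k ∧ ((j' : ℕ) < j ∨ ((j' : ℕ) = j ∧ i' < i))),
      MeasurableSpace.comap (P l j' i') inferInstance)

/-- A run of `K` iterations of the stochastic Frank–Wolfe algorithm at the points `xᵢ`, with
`n k` simulations at iteration `k`, on the probability space `(Ω, Pr)`:
`y k` are the iterates, `ybar k` the best responses, `P k j i` the Bernoulli variables. -/
structure IsSFWRun [MeasurableSpace Y] [MeasurableSpace Ω] [CompleteSpace H]
    (F : X → Set Y) (g : graph F → H) (f : H → ℝ) {N : ℕ} (x : Fin N → X)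
    (K : ℕ) (n : ℕ → ℕ) (Pr : Measure Ω)
    (y ybar : ℕ → Ω → (i : Fin N) → F (x i)) (P : (k : ℕ) → Fin (n k) → Fin N → Ω → Bool) :
    Prop where
  measurable_y : ∀ k ≤ K, Measurable (y k)
  measurable_ybar : ∀ k < K, Measurable (ybar k)
  measurable_P : ∀ k < K, ∀ j i, Measurable (P k j i)
  pos_n : ∀ k < K, 1 ≤ n k
  best_response : ∀ k < K, ∀ ω i,
    ybar k ω i ∈ BR F g (gradient f (aggregate F g x (y k ω))) (x i)
  law_P : ∀ k < K, ∀ j i, Pr.map (P k j i) = bernoulliMeasure true false (stepSize k)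
  indep_P : ∀ k < K, ∀ j i,
    Indep (MeasurableSpace.comap (P k j i) inferInstance) (past F x n y ybar P k j i) Pr
  update_mem : ∀ k < K, ∀ ω, ∃ j,
    y (k + 1) ω = candidate F x (y k ω) (ybar k ω) (fun i => P k j i ω)
  update_min : ∀ k < K, ∀ ω j, f (aggregate F g x (y (k + 1) ω)) ≤
    f (aggregate F g x (candidate F x (y k ω) (ybar k ω) (fun i => P k j i ω)))

end SFW

end MFO

end

/-!
Two errors add up. For the discretized problem, convexity and the optimality of the best responses
bound the Frank–Wolfe gap from below by the current suboptimality; as the Bernoulli variables are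
independent of the past and of each other, the second order term of the descent inequality has
expectation at most `(L D / 2) (ω² + ω (1 - ω) / N)` for the step `ω`. The resulting recursion
gives the rate `L D (2 / (K + 1) + 1 / (2 N))`.

For the passage between the empirical measure and `m`, the Lipschitz property of
`x ↦ {g (x, y) | y ∈ Z_x}` allows mass to be moved along an optimal transport plan at a cost of at
most `Lg d₁` in the aggregate, hence of at most `C Lg d₁` in the value. This is done twice, once for
the output of the algorithm and once for the comparison of the optimal values. As one of the two
marginals is finitely supported, plans are given by densities indexed by the atoms.
-/

noncomputable section

namespace MFO

open Filter Topology

/-! ### Convex functions with Lipschitz gradient -/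

section Gradient

variable {H : Type*} [NormedAddCommGroup H] [InnerProductSpace ℝ H] [CompleteSpace H]

theorem hasDerivAt_comp_add_smul {f : H → ℝ} (hf : Differentiable ℝ f) (b v : H) (t : ℝ) :
    HasDerivAt (fun t : ℝ => f (b + t • v)) (inner ℝ (gradient f (b + t • v)) v) t := by
  have hline : HasDerivAt (fun t : ℝ => b + t • v) v t := by
    simpa using ((hasDerivAt_id t).smul_const v).const_add b
  exact (hf (b + t • v)).hasGradientAt.hasFDerivAt.comp_hasDerivAt t hline

theorem add_inner_gradient_le_of_convexOn {f : H → ℝ} (hc : ConvexOn ℝ Set.univ f)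
    (hf : Differentiable ℝ f) (a b : H) : f b + inner ℝ (gradient f b) (a - b) ≤ f a := by
  have hline : ConvexOn ℝ Set.univ fun t : ℝ => f (b + t • (a - b)) := by
    have hcomp : (fun t : ℝ => f (b + t • (a - b))) = f ∘ AffineMap.lineMap b a := by
      ext t
      simp [AffineMap.lineMap_apply, add_comm]
    rw [hcomp]
    exact hc.comp_affineMap (AffineMap.lineMap b a)
  have hslope := hline.le_slope_of_hasDerivAt (Set.mem_univ 0) (Set.mem_univ 1) zero_lt_one
    (hasDerivAt_comp_add_smul hf b (a - b) 0)
  simp only [zero_smul, add_zero, slope, sub_zero, inv_one, one_smul, vsub_eq_sub,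
    add_sub_cancel] at hslope
  linarith

theorem inner_gradient_add_smul_le {f : H → ℝ} {L : ℝ≥0} (hL : LipschitzWith L (gradient f))
    (b v : H) {t : ℝ} (ht : 0 ≤ t) :
    inner ℝ (gradient f (b + t • v)) v ≤ inner ℝ (gradient f b) v + L * t * ‖v‖ ^ 2 := by
  have hdiff : ‖gradient f (b + t • v) - gradient f b‖ ≤ L * (t * ‖v‖) := by
    simpa [norm_smul, abs_of_nonneg ht] using hL.norm_sub_le (b + t • v) b
  calc inner ℝ (gradient f (b + t • v)) v
      = inner ℝ (gradient f b) v + inner ℝ (gradient f (b + t • v) - gradient f b) v := by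
        rw [← inner_add_left, add_sub_cancel]
    _ ≤ inner ℝ (gradient f b) v + L * (t * ‖v‖) * ‖v‖ := by
        gcongr
        exact (real_inner_le_norm _ _).trans (by gcongr)
    _ = inner ℝ (gradient f b) v + L * t * ‖v‖ ^ 2 := by ring

theorem le_add_inner_gradient_add_norm_sq {f : H → ℝ} {L : ℝ≥0}
    (hL : LipschitzWith L (gradient f)) (hf : Differentiable ℝ f) (b v : H) :
    f (b + v) ≤ f b + inner ℝ (gradient f b) v + L / 2 * ‖v‖ ^ 2 := by
  set ψ : ℝ → ℝ := fun t => f (b + t • v) - (t * inner ℝ (gradient f b) v + L / 2 * ‖v‖ ^ 2 * t ^ 2)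
    with hψ
  have hderiv : ∀ t, HasDerivAt ψ (inner ℝ (gradient f (b + t • v)) v -
      (inner ℝ (gradient f b) v + L / 2 * ‖v‖ ^ 2 * (2 * t))) t := fun t => by
    refine (hasDerivAt_comp_add_smul hf b v t).sub (HasDerivAt.add ?_ ?_)
    · simpa using (hasDerivAt_id t).mul_const (inner ℝ (gradient f b) v)
    · simpa using (hasDerivAt_pow 2 t).const_mul (L / 2 * ‖v‖ ^ 2 : ℝ)
  have hanti : AntitoneOn ψ (Set.Icc 0 1) := by
    refine antitoneOn_of_deriv_nonpos (convex_Icc 0 1)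
      (fun t _ => (hderiv t).continuousAt.continuousWithinAt)
      (fun t _ => (hderiv t).differentiableAt.differentiableWithinAt) fun t ht => ?_
    rw [interior_Icc] at ht
    rw [(hderiv t).deriv]
    linarith [inner_gradient_add_smul_le hL b v ht.1.le]
  have hle := hanti (Set.left_mem_Icc.2 zero_le_one) (Set.right_mem_Icc.2 zero_le_one) zero_le_one
  simp only [hψ, zero_smul, one_smul, add_zero, one_mul, zero_mul, one_pow, mul_one,
    zero_pow two_ne_zero, mul_zero, sub_zero] at hle
  linarith

theorem norm_gradient_le_of_norm_le {f : H → ℝ} {L : ℝ≥0} (hL : LipschitzWith L (gradient f))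
    {R : ℝ} {v : H} (hv : ‖v‖ ≤ R) : ‖gradient f v‖ ≤ ‖gradient f 0‖ + L * R := by
  have hdiff : ‖gradient f v - gradient f 0‖ ≤ L * ‖v‖ := by simpa using hL.norm_sub_le v 0
  calc ‖gradient f v‖ ≤ ‖gradient f 0‖ + ‖gradient f v - gradient f 0‖ :=
        norm_le_norm_add_norm_sub' _ _
    _ ≤ ‖gradient f 0‖ + L * R := by gcongr; exact hdiff.trans (by gcongr)

theorem norm_le_norm_zero_add_mul_norm {f : H → ℝ} {L : ℝ≥0} (hL : LipschitzWith L (gradient f))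
    (hf : Differentiable ℝ f) (v : H) :
    ‖f v‖ ≤ ‖f 0‖ + (‖gradient f 0‖ + L * ‖v‖) * ‖v‖ := by
  have hfderiv (w : H) (hw : w ∈ Metric.closedBall 0 ‖v‖) :
      ‖fderiv ℝ f w‖ ≤ ‖gradient f 0‖ + L * ‖v‖ := by
    simpa [gradient] using norm_gradient_le_of_norm_le hL (mem_closedBall_zero_iff.1 hw)
  have hdiff : ‖f v - f 0‖ ≤ (‖gradient f 0‖ + L * ‖v‖) * ‖v - 0‖ :=
    (convex_closedBall (0 : H) ‖v‖).norm_image_sub_le_of_norm_fderiv_le (fun w _ => hf w) hfderiv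
      (Metric.mem_closedBall_self (norm_nonneg v)) (mem_closedBall_zero_iff.2 le_rfl)
  rw [sub_zero] at hdiff
  exact (norm_le_norm_add_norm_sub' _ _).trans (add_le_add_right hdiff _)

section Integrability

variable {Ω : Type*} {mΩ : MeasurableSpace Ω} {Pr : Measure Ω} [IsFiniteMeasure Pr] {f : H → ℝ}
  {L : ℝ≥0} {u : Ω → H}

theorem memLp_gradient_comp (hL : LipschitzWith L (gradient f)) (hu : MemLp u 2 Pr) :
    MemLp (fun ω => gradient f (u ω)) 2 Pr := by
  have hsub : MemLp (fun ω => gradient f (u ω) - gradient f 0) 2 Pr :=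
    (hL.sub (LipschitzWith.const (gradient f 0))).comp_memLp (sub_self _) hu
  simpa only [Pi.add_def, sub_add_cancel] using hsub.add (memLp_const (gradient f 0))

theorem integrable_comp_of_memLp_two (hL : LipschitzWith L (gradient f))
    (hf : Differentiable ℝ f) (hu : MemLp u 2 Pr) : Integrable (fun ω => f (u ω)) Pr := by
  have hbound : Integrable
      (fun ω => ‖f 0‖ + ‖gradient f 0‖ * ‖u ω‖ + L * ‖u ω‖ ^ 2) Pr :=
    ((integrable_const _).add ((hu.integrable one_le_two).norm.const_mul _)).add
      (hu.integrable_norm_pow'.const_mul _)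
  refine hbound.mono' (hf.continuous.comp_aestronglyMeasurable hu.1) (.of_forall fun ω => ?_)
  exact (norm_le_norm_zero_add_mul_norm hL hf (u ω)).trans_eq (by ring)

end Integrability

end Gradient

/-! ### Measurable selections of compact-valued maps -/

section Selection

open Metric

variable {α Z : Type*} [MeasurableSpace α] [MetricSpace Z]

/-- A compact-valued map with non-empty values which hits closed sets measurably. -/
structure MeasurableCompactValued (S : α → Set Z) : Prop where
  isCompact : ∀ a, IsCompact (S a)
  nonempty : ∀ a, (S a).Nonempty
  measurable_hit : ∀ C, IsClosed C → MeasurableSet {a | (S a ∩ C).Nonempty}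

theorem infEDist_le_iff_of_isCompact {K : Set Z} (hK : IsCompact K) (q : Z) {r : ℝ≥0∞}
    (hr : r ≠ ⊤) : infEDist q K ≤ r ↔ ∃ z ∈ K, edist q z ≤ r := by
  constructor
  · intro h
    have hne : K.Nonempty := by
      rw [Set.nonempty_iff_ne_empty]
      rintro rfl
      exact hr (top_le_iff.1 (infEDist_empty.symm.trans_le h))
    obtain ⟨z, hz, hzq⟩ := hK.exists_infEDist_eq_edist hne q
    exact ⟨z, hz, hzq ▸ h⟩
  · rintro ⟨z, hz, hzr⟩
    exact (infEDist_le_edist_of_mem hz).trans hzr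

/-- The points of `K` closest to `q`. -/
def nearestPoints (q : Z) (K : Set Z) : Set Z := K ∩ {z | edist q z ≤ infEDist q K}

theorem isCompact_nearestPoints {K : Set Z} (hK : IsCompact K) (q : Z) :
    IsCompact (nearestPoints q K) :=
  hK.inter_right (isClosed_le (by fun_prop) continuous_const)

theorem nearestPoints_inter_nonempty_iff {K C : Set Z} (hK : IsCompact K) (hne : K.Nonempty)
    (hC : IsClosed C) (q : Z) :
    (nearestPoints q K ∩ C).Nonempty ↔ infEDist q (K ∩ C) ≤ infEDist q K := by
  rw [infEDist_le_iff_of_isCompact (hK.inter_right hC) q (infEDist_ne_top hne)]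
  exact ⟨fun ⟨z, ⟨hzK, hzq⟩, hzC⟩ => ⟨z, ⟨hzK, hzC⟩, hzq⟩,
    fun ⟨z, ⟨hzK, hzC⟩, hzq⟩ => ⟨z, ⟨hzK, hzq⟩, hzC⟩⟩

theorem MeasurableCompactValued.measurable_infEDist {S : α → Set Z}
    (hS : MeasurableCompactValued S) (q : Z) {C : Set Z} (hC : IsClosed C) :
    Measurable fun a => infEDist q (S a ∩ C) := by
  refine measurable_of_Iic fun r => ?_
  rcases eq_or_ne r ⊤ with rfl | hr
  · simp
  · convert hS.measurable_hit (C ∩ {z | edist q z ≤ r})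
      (hC.inter (isClosed_le (by fun_prop) continuous_const)) using 1
    ext a
    rw [Set.mem_preimage, Set.mem_Iic,
      infEDist_le_iff_of_isCompact ((hS.isCompact a).inter_right hC) q hr, Set.mem_ofPred_eq,
      ← Set.inter_assoc]
    rfl

theorem MeasurableCompactValued.nearestPoints {S : α → Set Z}
    (hS : MeasurableCompactValued S) (q : Z) :
    MeasurableCompactValued fun a => nearestPoints q (S a) where
  isCompact a := isCompact_nearestPoints (hS.isCompact a) q
  nonempty a := by
    simpa using (nearestPoints_inter_nonempty_iff (hS.isCompact a) (hS.nonempty a)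
      isClosed_univ q).2 (by simp)
  measurable_hit C hC := by
    simp only [nearestPoints_inter_nonempty_iff (hS.isCompact _) (hS.nonempty _) hC]
    exact measurableSet_le (hS.measurable_infEDist q hC)
      (by simpa using hS.measurable_infEDist q isClosed_univ)

/-- Successive refinement of `K` to the points nearest to the terms of `q`; along a dense sequence
it shrinks to a single point, which serves as a canonical selection from `K`. -/
def iteratedNearestPoints (q : ℕ → Z) (K : Set Z) : ℕ → Set Z
  | 0 => K
  | n + 1 => nearestPoints (q n) (iteratedNearestPoints q K n)

theorem iteratedNearestPoints_antitone (q : ℕ → Z) (K : Set Z) :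
    Antitone (iteratedNearestPoints q K) :=
  antitone_nat_of_succ_le fun _ => Set.inter_subset_left

theorem MeasurableCompactValued.iteratedNearestPoints {S : α → Set Z}
    (hS : MeasurableCompactValued S) (q : ℕ → Z) (n : ℕ) :
    MeasurableCompactValued fun a => iteratedNearestPoints q (S a) n := by
  induction n with
  | zero => exact hS
  | succ n ih => exact ih.nearestPoints (q n)

theorem subsingleton_iInter_iteratedNearestPoints {q : ℕ → Z} (hq : DenseRange q) (K : Set Z) :
    (⋂ n, iteratedNearestPoints q K n).Subsingleton := by
  intro z hz z' hz'
  have hle : ∀ {z z'}, z ∈ ⋂ n, iteratedNearestPoints q K n →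
      z' ∈ ⋂ n, iteratedNearestPoints q K n → ∀ n, edist (q n) z ≤ edist (q n) z' :=
    fun hz hz' n => ((Set.mem_iInter.1 hz (n + 1)).2).trans
      (infEDist_le_edist_of_mem (Set.mem_iInter.1 hz' n))
  have heq : (fun w => edist w z) = fun w => edist w z' := by
    refine Continuous.ext_on hq (by fun_prop) (by fun_prop) ?_
    rintro _ ⟨n, rfl⟩
    exact le_antisymm (hle hz hz' n) (hle hz' hz n)
  simpa using (congrFun heq z).symm

theorem MeasurableCompactValued.nonempty_iInter_iteratedNearestPoints_inter {S : α → Set Z}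
    (hS : MeasurableCompactValued S) (q : ℕ → Z) (a : α) {C : Set Z} (hC : IsClosed C)
    (hne : ∀ n, (MFO.iteratedNearestPoints q (S a) n ∩ C).Nonempty) :
    ((⋂ n, MFO.iteratedNearestPoints q (S a) n) ∩ C).Nonempty := by
  rw [Set.iInter_inter]
  have hcompact := fun n => ((hS.iteratedNearestPoints q n).isCompact a).inter_right hC
  exact IsCompact.nonempty_iInter_of_sequence_nonempty_isCompact_isClosed _
    (fun n => Set.inter_subset_inter_left _ (iteratedNearestPoints_antitone q _ n.le_succ)) hne
    (hcompact 0) fun n => (hcompact n).isClosed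

theorem MeasurableCompactValued.exists_measurable_selection [TopologicalSpace.SeparableSpace Z]
    [MeasurableSpace Z] [BorelSpace Z] {S : α → Set Z} (hS : MeasurableCompactValued S) :
    ∃ s : α → Z, Measurable s ∧ ∀ a, s a ∈ S a := by
  rcases isEmpty_or_nonempty α with hα | ⟨⟨a₀⟩⟩
  · exact ⟨fun a => (hα.false a).elim, measurable_of_empty _, fun a => (hα.false a).elim⟩
  have : Nonempty Z := ⟨(hS.nonempty a₀).some⟩
  set q := TopologicalSpace.denseSeq Z
  have hne : ∀ a, (⋂ n, MFO.iteratedNearestPoints q (S a) n).Nonempty := fun a => by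
    simpa using hS.nonempty_iInter_iteratedNearestPoints_inter q a isClosed_univ fun n => by
      simpa using (hS.iteratedNearestPoints q n).nonempty a
  choose s hs using hne
  refine ⟨s, measurable_of_isClosed fun C hC => ?_, fun a => Set.mem_iInter.1 (hs a) 0⟩
  have hpre : s ⁻¹' C = ⋂ n, {a | (MFO.iteratedNearestPoints q (S a) n ∩ C).Nonempty} := by
    ext a
    rw [Set.mem_iInter]
    refine ⟨fun h n => ⟨s a, Set.mem_iInter.1 (hs a) n, h⟩, fun h => ?_⟩
    obtain ⟨z, hz, hzC⟩ := hS.nonempty_iInter_iteratedNearestPoints_inter q a hC h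
    rwa [Set.mem_preimage, subsingleton_iInter_iteratedNearestPoints
      (TopologicalSpace.denseRange_denseSeq Z) _ (hs a) hz]
  rw [hpre]
  exact MeasurableSet.iInter fun n => (hS.iteratedNearestPoints q n).measurable_hit C hC

end Selection

/-! ### Images of bounded closed convex sets of Hilbert spaces -/

section Hilbert

variable {V W : Type*} [NormedAddCommGroup V] [InnerProductSpace ℝ V]

theorem norm_sub_sq_le_of_forall_norm_le {A : Set V} (hA : Convex ℝ A) {u v : V} (hu : u ∈ A)
    (hmin : ∀ w ∈ A, ‖u‖ ≤ ‖w‖) (hv : v ∈ A) : ‖u - v‖ ^ 2 ≤ 2 * (‖v‖ ^ 2 - ‖u‖ ^ 2) := by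
  have hmid := hmin _ (hA hu hv (by norm_num : (0 : ℝ) ≤ 1 / 2) (by norm_num : (0 : ℝ) ≤ 1 / 2)
    (by norm_num))
  rw [← smul_add, norm_smul, Real.norm_of_nonneg (by norm_num)] at hmid
  have hpar := parallelogram_law_with_norm ℝ u v
  nlinarith [norm_nonneg u, norm_nonneg (u + v)]

variable [CompleteSpace V]

theorem exists_forall_norm_le_of_convex {A : Set V} (hne : A.Nonempty) (hclosed : IsClosed A)
    (hconv : Convex ℝ A) : ∃ u ∈ A, ∀ w ∈ A, ‖u‖ ≤ ‖w‖ := by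
  obtain ⟨u, hu, hinf⟩ := exists_norm_eq_iInf_of_complete_convex hne hclosed.isComplete hconv 0
  refine ⟨u, hu, fun w hw => ?_⟩
  have hle := ciInf_le (f := fun w : A => ‖(0 : V) - w‖)
    ⟨0, Set.forall_mem_range.2 fun _ => norm_nonneg _⟩ ⟨w, hw⟩
  rw [← hinf] at hle
  simpa using hle

/-- The points of minimal norm form a Cauchy sequence, by the parallelogram law. -/
theorem nonempty_iInter_of_antitone_of_convex {A : ℕ → Set V} (hanti : Antitone A)
    (hne : ∀ n, (A n).Nonempty) (hclosed : ∀ n, IsClosed (A n)) (hconv : ∀ n, Convex ℝ (A n))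
    (hb : Bornology.IsBounded (A 0)) : (⋂ n, A n).Nonempty := by
  obtain ⟨R, hR⟩ := isBounded_iff_forall_norm_le.1 hb
  choose u hu hmin using fun n => exists_forall_norm_le_of_convex (hne n) (hclosed n) (hconv n)
  have hmono : Monotone fun n => ‖u n‖ ^ 2 := fun n k hnk =>
    pow_le_pow_left₀ (norm_nonneg _) (hmin n _ (hanti hnk (hu k))) 2
  have hbdd : BddAbove (Set.range fun n => ‖u n‖ ^ 2) :=
    ⟨R ^ 2, Set.forall_mem_range.2 fun n =>
      pow_le_pow_left₀ (norm_nonneg _) (hR _ (hanti (Nat.zero_le n) (hu n))) 2⟩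
  set l := ⨆ n, ‖u n‖ ^ 2
  have hlim : Tendsto (fun n => ‖u n‖ ^ 2) atTop (𝓝 l) := tendsto_atTop_ciSup hmono hbdd
  have hcauchy : CauchySeq u := by
    refine cauchySeq_of_le_tendsto_0' (fun n => √(2 * (l - ‖u n‖ ^ 2))) (fun n k hnk => ?_) ?_
    · rw [dist_eq_norm]
      refine Real.le_sqrt_of_sq_le ?_
      have hdist := norm_sub_sq_le_of_forall_norm_le (hconv n) (hu n) (hmin n) (hanti hnk (hu k))
      have hle : ‖u k‖ ^ 2 ≤ l := le_ciSup hbdd k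
      linarith
    · simpa using ((hlim.const_sub l).const_mul 2).sqrt
  obtain ⟨v, hv⟩ := cauchySeq_tendsto_of_complete hcauchy
  refine ⟨v, Set.mem_iInter.2 fun n => (hclosed n).mem_of_tendsto hv ?_⟩
  filter_upwards [eventually_ge_atTop n] with k hk using hanti hk (hu k)

theorem isClosed_image_of_convex_of_isBounded [NormedAddCommGroup W] [NormedSpace ℝ W]
    (T : V →L[ℝ] W) {C : Set V} (hC : IsClosed C) (hconv : Convex ℝ C)
    (hb : Bornology.IsBounded C) : IsClosed (T '' C) := by
  refine isClosed_of_closure_subset fun p hp => ?_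
  let A : ℕ → Set V := fun n => C ∩ T ⁻¹' Metric.closedBall p (1 / ((n : ℝ) + 1))
  obtain ⟨v, hv⟩ := nonempty_iInter_of_antitone_of_convex (A := A)
    (fun n k hnk => Set.inter_subset_inter_right _ <| Set.preimage_mono <|
      Metric.closedBall_subset_closedBall (Nat.one_div_le_one_div hnk))
    (fun n => by
      obtain ⟨_, ⟨v, hv, rfl⟩, hd⟩ :=
        Metric.mem_closure_iff.1 hp _ (Nat.one_div_pos_of_nat (n := n))
      exact ⟨v, hv, by simpa [dist_comm] using hd.le⟩)
    (fun n => hC.inter (Metric.isClosed_closedBall.preimage T.continuous))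
    (fun n => hconv.inter ((convex_closedBall _ _).linear_preimage T.toLinearMap))
    (hb.subset Set.inter_subset_left)
  rw [Set.mem_iInter] at hv
  refine ⟨v, (hv 0).1, ?_⟩
  rw [← dist_le_zero]
  exact ge_of_tendsto' tendsto_one_div_add_atTop_nhds_zero_nat fun n => (hv n).2

end Hilbert

/-! ### Allocations of a finite measure -/

section Allocation

variable {X ι : Type*} [MeasurableSpace X] [Fintype ι]

/-- An allocation of `X` to the sites `ι`, that is, a relaxed partition: the fraction `w i x` of
the mass at `x` goes to the site `i`. -/
structure IsAllocation (w : ι → X → ℝ) : Prop where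
  measurable : ∀ i, Measurable (w i)
  nonneg : ∀ i x, 0 ≤ w i x
  sum_eq_one : ∀ x, ∑ i, w i x = 1

namespace IsAllocation

variable {w : ι → X → ℝ}

theorem le_one (hw : IsAllocation w) (i : ι) (x : X) : w i x ≤ 1 := by
  rw [← hw.sum_eq_one x]
  exact Finset.single_le_sum (f := fun j => w j x) (fun j _ => hw.nonneg j x) (Finset.mem_univ i)

theorem norm_le_one (hw : IsAllocation w) (i : ι) (x : X) : ‖w i x‖ ≤ 1 := by
  rw [Real.norm_of_nonneg (hw.nonneg i x)]
  exact hw.le_one i x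

theorem integrable_mul (hw : IsAllocation w) {m : Measure X} {d : X → ℝ} (hd : Integrable d m)
    (i : ι) : Integrable (fun x => w i x * d x) m :=
  hd.bdd_mul (hw.measurable i).aestronglyMeasurable (Eventually.of_forall (hw.norm_le_one i))

theorem memLp (hw : IsAllocation w) {m : Measure X} [IsFiniteMeasure m] {p : ℝ≥0∞} (i : ι) :
    MemLp (w i) p m :=
  MemLp.of_bound (hw.measurable i).aestronglyMeasurable 1 (Eventually.of_forall (hw.norm_le_one i))

end IsAllocation

section Partition

variable [DecidableEq ι]

/-- The allocation which sends all the mass at `x` to the site `k x`. -/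
def partitionAllocation (k : X → ι) (i : ι) (x : X) : ℝ := if k x = i then 1 else 0

variable [MeasurableSpace ι] [MeasurableSingletonClass ι]

theorem isAllocation_partitionAllocation {k : X → ι} (hk : Measurable k) :
    IsAllocation (partitionAllocation k) where
  measurable i := Measurable.ite (hk (measurableSet_singleton i)) measurable_const measurable_const
  nonneg i x := by
    unfold partitionAllocation
    split_ifs <;> norm_num
  sum_eq_one x := by simp [partitionAllocation]

theorem sum_integral_partitionAllocation_mul {m : Measure X} {k : X → ι} (hk : Measurable k)
    {e : ι → X → ℝ} (he : ∀ i, Integrable (e i) m) :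
    ∑ i, ∫ x, partitionAllocation k i x * e i x ∂m = ∫ x, e (k x) x ∂m := by
  rw [← integral_finsetSum _ fun i _ =>
    (isAllocation_partitionAllocation hk).integrable_mul (he i) i]
  simp [partitionAllocation]

end Partition

section L2

theorem convex_nonneg_Lp (m : Measure X) : Convex ℝ {v : Lp ℝ 2 m | 0 ≤ v} := by
  intro u hu v hv a b ha hb _
  rw [Set.mem_ofPred_eq, ← Lp.coeFn_nonneg] at *
  filter_upwards [hu, hv, Lp.coeFn_add (a • u) (b • v), Lp.coeFn_smul a u, Lp.coeFn_smul b v]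
    with x hux hvx hadd hau hbv
  rw [hadd, Pi.add_apply, hau, hbv]
  exact add_nonneg (mul_nonneg ha hux) (mul_nonneg hb hvx)

variable (m : Measure X) [IsFiniteMeasure m]

/-- The set of allocations in `L²`. -/
def allocationSet : Set (PiLp 2 fun _ : ι => Lp ℝ 2 m) :=
  {u | (∀ i, 0 ≤ u i) ∧ ∑ i, u i = (memLp_const (1 : ℝ)).toLp (fun _ => (1 : ℝ))}

theorem isClosed_allocationSet : IsClosed (allocationSet (ι := ι) m) := by
  have hcoord : ∀ i, Continuous fun u : PiLp 2 fun _ : ι => Lp ℝ 2 m => u i :=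
    fun i => (PiLp.proj (𝕜 := ℝ) 2 (fun _ : ι => Lp ℝ 2 m) i).continuous
  have hnonneg : IsClosed {u : PiLp 2 fun _ : ι => Lp ℝ 2 m | ∀ i, 0 ≤ u i} := by
    rw [Set.ofPred_forall]
    exact isClosed_iInter fun i => isClosed_le continuous_const (hcoord i)
  exact hnonneg.inter (isClosed_eq (continuous_finsetSum _ fun i _ => hcoord i) continuous_const)

theorem convex_allocationSet : Convex ℝ (allocationSet (ι := ι) m) := by
  rintro u ⟨hu, hu_sum⟩ v ⟨hv, hv_sum⟩ a b ha hb hab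
  refine ⟨fun i => convex_nonneg_Lp m (hu i) (hv i) ha hb hab, ?_⟩
  simp only [PiLp.add_apply, PiLp.smul_apply, Finset.sum_add_distrib, ← Finset.smul_sum, hu_sum,
    hv_sum]
  rw [← add_smul, hab, one_smul]

theorem isBounded_allocationSet : Bornology.IsBounded (allocationSet (ι := ι) m) := by
  set e : Lp ℝ 2 m := (memLp_const (1 : ℝ)).toLp (fun _ => (1 : ℝ))
  refine isBounded_iff_forall_norm_le.2 ⟨√(∑ _i : ι, ‖e‖ ^ 2), ?_⟩
  rintro u ⟨hu, hu_sum⟩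
  rw [PiLp.norm_eq_of_L2]
  refine Real.sqrt_le_sqrt (Finset.sum_le_sum fun i _ => pow_le_pow_left₀ (norm_nonneg _) ?_ 2)
  have hle : u i ≤ e :=
    (Finset.single_le_sum (f := fun j => u j) (fun j _ => hu j) (Finset.mem_univ i)).trans_eq hu_sum
  refine norm_le_norm_of_abs_le_abs ?_
  rwa [abs_of_nonneg (hu i), abs_of_nonneg ((hu i).trans hle)]

variable {m}

theorem IsAllocation.toLp_mem_allocationSet {w : ι → X → ℝ} (hw : IsAllocation w) :
    WithLp.toLp 2 (fun i => (hw.memLp i).toLp (w i)) ∈ allocationSet m := by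
  have hcoe : ∀ᵐ x ∂m, ∀ i, (hw.memLp (m := m) i).toLp (p := 2) (w i) x = w i x :=
    ae_all_iff.2 fun i => (hw.memLp i).coeFn_toLp
  refine ⟨fun i => ?_, Lp.ext ?_⟩
  · rw [← Lp.coeFn_nonneg]
    filter_upwards [hcoe] with x hx
    exact (hw.nonneg i x).trans_eq (hx i).symm
  · filter_upwards [hcoe, (memLp_const (1 : ℝ)).coeFn_toLp (p := 2) (μ := m),
      Lp.coeFn_finsetSum Finset.univ (fun i => (hw.memLp (m := m) i).toLp (p := 2) (w i))]
      with x hx hone hsum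
    rw [hone, hsum, Finset.sum_apply]
    simp only [hx, hw.sum_eq_one]

theorem ae_nonneg_and_sum_eq_one_of_mem_allocationSet {u : PiLp 2 fun _ : ι => Lp ℝ 2 m}
    (hu : u ∈ allocationSet m) : ∀ᵐ x ∂m, (∀ i, 0 ≤ u i x) ∧ ∑ i, u i x = 1 := by
  filter_upwards [ae_all_iff.2 fun i => (Lp.coeFn_nonneg _).2 (hu.1 i),
    (memLp_const (1 : ℝ)).coeFn_toLp (p := 2) (μ := m),
    Lp.coeFn_finsetSum Finset.univ (fun i => u i)] with x hnonneg hone hsum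
  rw [hu.2, hone, Finset.sum_apply] at hsum
  exact ⟨hnonneg, hsum.symm⟩

theorem exists_isAllocation_of_mem_allocationSet [Nonempty ι] {u : PiLp 2 fun _ : ι => Lp ℝ 2 m}
    (hu : u ∈ allocationSet m) : ∃ w : ι → X → ℝ, IsAllocation w ∧ ∀ i, w i =ᵐ[m] u i := by
  classical
  have hmeas : ∀ i, Measurable (u i) := fun i => (Lp.stronglyMeasurable (u i)).measurable
  let G : Set X := {x | (∀ i, 0 ≤ u i x) ∧ ∑ i, u i x = 1}
  have hG : MeasurableSet G := by
    refine MeasurableSet.inter ?_ (measurableSet_eq_fun (by fun_prop) measurable_const)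
    change MeasurableSet {x | ∀ i, 0 ≤ u i x}
    rw [Set.ofPred_forall]
    exact MeasurableSet.iInter fun i => measurableSet_le measurable_const (hmeas i)
  let i₀ : ι := Classical.arbitrary ι
  refine ⟨fun i x => if x ∈ G then u i x else if i₀ = i then 1 else 0,
    ⟨fun i => Measurable.ite hG (hmeas i) measurable_const, fun i x => ?_, fun x => ?_⟩,
    fun i => ?_⟩
  · dsimp only
    split_ifs with hx hi
    exacts [hx.1 i, zero_le_one, le_rfl]
  · by_cases hx : x ∈ G
    · simpa only [hx, if_true] using hx.2
    · simp [hx]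
  · filter_upwards [ae_nonneg_and_sum_eq_one_of_mem_allocationSet hu] with x hx
    exact if_pos hx

end L2

end Allocation

/-! ### Duality for allocation problems -/

section AllocationDuality

theorem exists_strongDual_add_lt_of_compact {E : Type*} [NormedAddCommGroup E] [NormedSpace ℝ E]
    {A : Set (E × ℝ)} (hA : IsCompact A) (hconv : Convex ℝ A) {a : E} {c : ℝ}
    (hac : ∀ c' ≤ c, (a, c') ∉ A) : ∃ α : StrongDual ℝ E, ∀ p ∈ A, α a + c < α p.1 + p.2 := by
  obtain ⟨φ, s, t, hs, hst, ht⟩ := geometric_hahn_banach_compact_closed hconv hA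
    ((convex_singleton a).prod (convex_Iic c)) (isClosed_singleton.prod isClosed_Iic) <|
      Set.disjoint_left.2 fun ⟨a', c'⟩ hA ⟨ha, hc⟩ => hac c' hc ((ha : a' = a) ▸ hA)
  set α : StrongDual ℝ E := φ.comp (ContinuousLinearMap.inl ℝ E ℝ)
  set β : ℝ := φ (0, 1)
  have hφ : ∀ p : E × ℝ, φ p = α p.1 + p.2 * β := fun ⟨v, r⟩ => by
    rw [← smul_eq_mul, ← map_smul φ]
    simp [α, ← map_add]
  have ht' : ∀ c' ≤ c, t < α a + c' * β := fun c' hc' => hφ (a, c') ▸ ht (a, c') ⟨rfl, hc'⟩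
  have hβ : β ≤ 0 := by
    by_contra! hpos
    have hlt := ht' (min c ((t - α a) / β)) (min_le_left _ _)
    have hle := mul_le_mul_of_nonneg_right (min_le_right c ((t - α a) / β)) hpos.le
    rw [div_mul_cancel₀ _ hpos.ne'] at hle
    linarith
  -- Since `A` is bounded, the slope `β` can be decreased to make it non-zero.
  obtain ⟨R, hR⟩ := isBounded_iff_forall_norm_le.1 hA.isBounded
  obtain ⟨ε, hε, hεR⟩ := exists_pos_mul_lt (sub_pos.2 hst) (|R| + |c|)
  have hβε : β - ε < 0 := by linarith
  refine ⟨(β - ε)⁻¹ • α, fun p hp => ?_⟩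
  have hp2 : ε * -p.2 ≤ ε * |R| := by
    gcongr
    exact (neg_le_abs _).trans (((norm_snd_le p).trans (hR p hp)).trans (le_abs_self R))
  have hc2 : ε * c ≤ ε * |c| := by gcongr; exact le_abs_self c
  have hlt : α p.1 + p.2 * (β - ε) < α a + c * (β - ε) := by
    linarith [hφ p ▸ hs p hp, ht' c le_rfl]
  have hscale : ∀ r q : ℝ, (β - ε)⁻¹ * r + q = (β - ε)⁻¹ * (r + q * (β - ε)) := fun r q => by
    field_simp [hβε.ne]
  simp only [smul_apply, smul_eq_mul, hscale]
  exact mul_lt_mul_of_neg_left hlt (inv_lt_zero.2 hβε)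

variable {X ι : Type*} [Fintype ι]

/-- The density `1 + ∑ᵢ dᵢ`. -/
def costWeight (d : ι → X → ℝ) (x : X) : ℝ := 1 + ∑ i, d i x

theorem one_le_costWeight {d : ι → X → ℝ} (hd0 : ∀ i x, 0 ≤ d i x) (x : X) : 1 ≤ costWeight d x :=
  le_add_of_nonneg_right (Finset.sum_nonneg fun i _ => hd0 i x)

theorem costWeight_pos {d : ι → X → ℝ} (hd0 : ∀ i x, 0 ≤ d i x) (x : X) : 0 < costWeight d x :=
  zero_lt_one.trans_le (one_le_costWeight hd0 x)

theorem le_costWeight {d : ι → X → ℝ} (hd0 : ∀ i x, 0 ≤ d i x) (i : ι) (x : X) :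
    d i x ≤ costWeight d x :=
  (Finset.single_le_sum (f := fun j => d j x) (fun j _ => hd0 j x) (Finset.mem_univ i)).trans
    (le_add_of_nonneg_left zero_le_one)

variable [MeasurableSpace X]

/-- The measure with density `1 + ∑ᵢ dᵢ`, for which the transport cost is a continuous functional
on `L²`, although `d` is only integrable for `m`. -/
def weightedMeasure (d : ι → X → ℝ) (m : Measure X) : Measure X :=
  m.withDensity fun x => ENNReal.ofReal (costWeight d x)

/-- The masses received by the sites, and the total cost, of an allocation `w`. -/
def massAndCost (d : ι → X → ℝ) (m : Measure X) (w : ι → X → ℝ) : (ι → ℝ) × ℝ :=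
  (fun i => ∫ x, w i x ∂m, ∑ i, ∫ x, w i x * d i x ∂m)

variable {d : ι → X → ℝ} {m : Measure X}

theorem measurable_costWeight (hdm : ∀ i, Measurable (d i)) : Measurable (costWeight d) := by
  unfold costWeight
  fun_prop

theorem isFiniteMeasure_weightedMeasure [IsFiniteMeasure m] (hdi : ∀ i, Integrable (d i) m) :
    IsFiniteMeasure (weightedMeasure d m) :=
  isFiniteMeasure_withDensity_ofReal
    ((integrable_const 1).add (integrable_finsetSum _ fun i _ => hdi i)).2

theorem memLp_div_costWeight [IsFiniteMeasure (weightedMeasure d m)] (hd0 : ∀ i x, 0 ≤ d i x)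
    (hdm : ∀ i, Measurable (d i)) {h : X → ℝ} (hm : Measurable h) (h0 : ∀ x, 0 ≤ h x)
    (hle : ∀ x, h x ≤ costWeight d x) :
    MemLp (fun x => h x / costWeight d x) 2 (weightedMeasure d m) := by
  refine MemLp.of_bound (hm.div (measurable_costWeight hdm)).aestronglyMeasurable 1
    (Eventually.of_forall fun x => ?_)
  have hpos := costWeight_pos hd0 x
  rw [Real.norm_of_nonneg (div_nonneg (h0 x) hpos.le), div_le_one hpos]
  exact hle x

theorem inner_toLp_div_costWeight (hd0 : ∀ i x, 0 ≤ d i x) (hdm : ∀ i, Measurable (d i))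
    {h : X → ℝ} (hh : MemLp (fun x => h x / costWeight d x) 2 (weightedMeasure d m))
    {v : Lp ℝ 2 (weightedMeasure d m)} {w : X → ℝ} (hv : w =ᵐ[weightedMeasure d m] v) :
    inner ℝ (hh.toLp _) v = ∫ x, w x * h x ∂m := by
  have hcongr : (fun x => inner ℝ (hh.toLp _ x) (v x)) =ᵐ[weightedMeasure d m]
      fun x => w x * (h x / costWeight d x) := by
    filter_upwards [hv, hh.coeFn_toLp] with x hx1 hx2
    simp [hx1, hx2]
  rw [L2.inner_def, integral_congr_ae hcongr, weightedMeasure,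
    integral_withDensity_eq_integral_toReal_smul
      (measurable_costWeight hdm).ennreal_ofReal (by simp)]
  refine integral_congr_ae (Eventually.of_forall fun x => ?_)
  have hpos := costWeight_pos hd0 x
  simp only [ENNReal.toReal_ofReal hpos.le, smul_eq_mul]
  field_simp

theorem exists_continuousLinearMap_eq_massAndCost [IsFiniteMeasure (weightedMeasure d m)]
    (hd0 : ∀ i x, 0 ≤ d i x) (hdm : ∀ i, Measurable (d i)) :
    ∃ T : (PiLp 2 fun _ : ι => Lp ℝ 2 (weightedMeasure d m)) →L[ℝ] (ι → ℝ) × ℝ,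
      ∀ u (w : ι → X → ℝ), (∀ i, w i =ᵐ[weightedMeasure d m] u i) → T u = massAndCost d m w := by
  have hone := memLp_div_costWeight (m := m) hd0 hdm (measurable_const (a := (1 : ℝ)))
    (fun _ => zero_le_one) (one_le_costWeight hd0)
  have hd := fun i => memLp_div_costWeight (m := m) hd0 hdm (hdm i) (hd0 i) (le_costWeight hd0 i)
  let coord := PiLp.proj (𝕜 := ℝ) 2 (fun _ : ι => Lp ℝ 2 (weightedMeasure d m))
  refine ⟨(ContinuousLinearMap.pi fun i => (innerSL ℝ (hone.toLp _)).comp (coord i)).prod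
    (∑ i, (innerSL ℝ ((hd i).toLp _)).comp (coord i)), fun u w h => ?_⟩
  refine Prod.ext (funext fun i => ?_) ?_
  · simpa [massAndCost, coord] using inner_toLp_div_costWeight hd0 hdm hone (h i)
  · simp only [ContinuousLinearMap.prod_apply, sum_apply, ContinuousLinearMap.comp_apply,
      innerSL_apply_apply, massAndCost]
    exact Finset.sum_congr rfl fun i _ => inner_toLp_div_costWeight hd0 hdm (hd i) (h i)

theorem isCompact_and_convex_image_massAndCost [Nonempty ι] [IsFiniteMeasure m]
    (hd0 : ∀ i x, 0 ≤ d i x) (hdm : ∀ i, Measurable (d i)) (hdi : ∀ i, Integrable (d i) m) :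
    IsCompact (massAndCost d m '' {w | IsAllocation w}) ∧
      Convex ℝ (massAndCost d m '' {w | IsAllocation w}) := by
  have := isFiniteMeasure_weightedMeasure hdi
  obtain ⟨T, hT⟩ := exists_continuousLinearMap_eq_massAndCost (m := m) hd0 hdm
  have himage : massAndCost d m '' {w | IsAllocation w} =
      T '' allocationSet (weightedMeasure d m) := by
    ext p
    constructor
    · rintro ⟨w, hw, rfl⟩
      exact ⟨_, IsAllocation.toLp_mem_allocationSet hw,
        hT _ w fun i => (IsAllocation.memLp hw i).coeFn_toLp.symm⟩
    · rintro ⟨u, hu, rfl⟩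
      obtain ⟨w, hw, hwu⟩ := exists_isAllocation_of_mem_allocationSet hu
      exact ⟨w, hw, (hT u w hwu).symm⟩
  have hbdd := isBounded_allocationSet (ι := ι) (weightedMeasure d m)
  have hconv := convex_allocationSet (ι := ι) (weightedMeasure d m)
  rw [himage]
  exact ⟨Metric.isCompact_of_isClosed_isBounded
    (isClosed_image_of_convex_of_isBounded T (isClosed_allocationSet _) hconv hbdd)
    (T.lipschitz.isBounded_image hbdd), hconv.linear_image T.toLinearMap⟩

theorem massAndCost_partitionAllocation [DecidableEq ι] [MeasurableSpace ι]
    [MeasurableSingletonClass ι] [IsFiniteMeasure m] (hdi : ∀ i, Integrable (d i) m)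
    {k : X → ι} (hk : Measurable k) (ψ : ι → ℝ) :
    ∑ i, (massAndCost d m (partitionAllocation k)).1 i * ψ i +
      (massAndCost d m (partitionAllocation k)).2 = ∫ x, (ψ (k x) + d (k x) x) ∂m := by
  have hw := isAllocation_partitionAllocation hk
  rw [← sum_integral_partitionAllocation_mul hk (e := fun i x => ψ i + d i x)
    fun i => (integrable_const _).add (hdi i), massAndCost, ← Finset.sum_add_distrib]
  refine Finset.sum_congr rfl fun i _ => ?_
  simp only [mul_add]
  rw [integral_add (hw.integrable_mul (integrable_const _) i) (hw.integrable_mul (hdi i) i),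
    integral_mul_const]

theorem exists_isAllocation_of_forall_partition [Nonempty ι] [MeasurableSpace ι]
    [MeasurableSingletonClass ι] [IsFiniteMeasure m] (hd0 : ∀ i x, 0 ≤ d i x)
    (hdm : ∀ i, Measurable (d i)) (hdi : ∀ i, Integrable (d i) m) {a : ι → ℝ} {c : ℝ}
    (hdual : ∀ ψ : ι → ℝ, ∃ k : X → ι, Measurable k ∧
      ∫ x, (ψ (k x) + d (k x) x) ∂m ≤ ∑ i, a i * ψ i + c) :
    ∃ w : ι → X → ℝ, IsAllocation w ∧ (∀ i, ∫ x, w i x ∂m = a i) ∧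
      ∑ i, ∫ x, w i x * d i x ∂m ≤ c := by
  classical
  by_contra! hcon
  obtain ⟨hcompact, hconv⟩ := isCompact_and_convex_image_massAndCost hd0 hdm hdi
  obtain ⟨α, hα⟩ := exists_strongDual_add_lt_of_compact hcompact hconv (a := a) (c := c) <| by
    rintro c' hc' ⟨w, hw, hwa⟩
    exact (hcon w hw (congrFun (congrArg Prod.fst hwa))).not_ge
      ((congrArg Prod.snd hwa).trans_le hc')
  obtain ⟨k, hk, hle⟩ := hdual fun i => α (Pi.single i 1)
  have hlt := hα _ (Set.mem_image_of_mem _ (isAllocation_partitionAllocation hk))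
  have hsum : ∀ v : ι → ℝ, α v = ∑ i, v i * α (Pi.single i 1) := fun v => by
    conv_lhs => rw [pi_eq_sum_univ' v]
    simp [map_sum]
  rw [hsum a, hsum (massAndCost d m _).1, massAndCost_partitionAllocation hdi hk] at hlt
  exact hlt.not_ge hle

end AllocationDuality

/-! ### Semi-discrete Kantorovich–Rubinstein duality -/

theorem exists_measurable_argmin {ι A : Type*} [Finite ι] [Nonempty ι] [MeasurableSpace ι]
    [MeasurableSpace A] {e : ι → A → ℝ} (he : ∀ i, Measurable (e i)) :
    ∃ k : A → ι, Measurable k ∧ ∀ a j, e (k a) a ≤ e j a := by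
  classical
  obtain ⟨s, hs⟩ := exists_surjective_nat ι
  have hargmin : ∀ a, ∃ n, ∀ j, e (s n) a ≤ e j a := fun a => by
    obtain ⟨i, hi⟩ := Finite.exists_min fun i => e i a
    obtain ⟨n, rfl⟩ := hs i
    exact ⟨n, hi⟩
  refine ⟨fun a => s (Nat.find (hargmin a)),
    (measurable_from_nat (f := s)).comp (measurable_find hargmin fun n => ?_),
    fun a => Nat.find_spec (hargmin a)⟩
  rw [Set.ofPred_forall]
  exact MeasurableSet.iInter fun j => measurableSet_le (he (s n)) (he j)

section Empirical

variable {A : Type*} [MeasurableSpace A] {N : ℕ}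

theorem lintegral_empirical (p : Fin N → A) {h : A → ℝ≥0∞} (hh : Measurable h) :
    ∫⁻ a, h a ∂(empirical p) = (N : ℝ≥0∞)⁻¹ * ∑ i, h (p i) := by
  simp [empirical, lintegral_smul_measure, lintegral_dirac' _ hh]

instance isProbabilityMeasure_empirical [NeZero N] (p : Fin N → A) :
    IsProbabilityMeasure (empirical p) := by
  refine ⟨?_⟩
  have h := lintegral_empirical p (measurable_const (a := (1 : ℝ≥0∞)))
  simpa [ENNReal.inv_mul_cancel, NeZero.ne N] using h

variable {E : Type*} [NormedAddCommGroup E] {φ : A → E}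

theorem integrable_empirical [NeZero N] (p : Fin N → A) (hφ : StronglyMeasurable φ) :
    Integrable φ (empirical p) :=
  (integrable_finsetSum_measure.2 fun _ _ => integrable_dirac' hφ (by simp)).smul_measure
    (by simp [NeZero.ne N])

theorem integral_empirical [NormedSpace ℝ E] [CompleteSpace E] (p : Fin N → A)
    (hφ : StronglyMeasurable φ) :
    ∫ a, φ a ∂(empirical p) = (N : ℝ)⁻¹ • ∑ i, φ (p i) := by
  rw [empirical, integral_smul_measure, integral_finsetSum_measure]
  · simp [integral_dirac' _ _ hφ]
  · exact fun i _ => integrable_dirac' hφ (by simp)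

end Empirical

section AllocationMeasure

variable {A B : Type*} [MeasurableSpace A] [MeasurableSpace B] {N : ℕ}

/-- The measure `∑ᵢ δ_{zᵢ} ⊗ (wᵢ m)`: the coupling in which the point `zᵢ` is matched with the
share `wᵢ m` of the measure `m`. -/
def allocationMeasure (z : Fin N → A) (w : Fin N → B → ℝ) (m : Measure B) : Measure (A × B) :=
  ∑ i, (Measure.dirac (z i)).prod (m.withDensity fun b => ENNReal.ofReal (w i b))

variable {z : Fin N → A} {w : Fin N → B → ℝ} {m : Measure B}

theorem lintegral_sum_allocation_mul (hw : IsAllocation w) {h : B → ℝ≥0∞} (hh : Measurable h) :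
    ∑ i, ∫⁻ b, ENNReal.ofReal (w i b) * h b ∂m = ∫⁻ b, h b ∂m := by
  rw [← lintegral_finsetSum Finset.univ (f := fun i b => ENNReal.ofReal (w i b) * h b)
    fun i _ => (hw.measurable i).ennreal_ofReal.mul hh]
  refine lintegral_congr fun b => ?_
  rw [← Finset.sum_mul, ← ENNReal.ofReal_sum_of_nonneg fun i _ => hw.nonneg i b, hw.sum_eq_one,
    ENNReal.ofReal_one, one_mul]

variable [SFinite m]

theorem lintegral_allocationMeasure (hw : IsAllocation w) {h : A × B → ℝ≥0∞} (hh : Measurable h) :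
    ∫⁻ p, h p ∂(allocationMeasure z w m) =
      ∑ i, ∫⁻ b, ENNReal.ofReal (w i b) * h (z i, b) ∂m := by
  rw [allocationMeasure, lintegral_finsetSum_measure]
  refine Finset.sum_congr rfl fun i _ => ?_
  rw [lintegral_prod _ hh.aemeasurable, lintegral_dirac' _ hh.lintegral_prod_right',
    lintegral_withDensity_eq_lintegral_mul _ (hw.measurable i).ennreal_ofReal (by fun_prop)]
  rfl

theorem map_snd_allocationMeasure (hw : IsAllocation w) :
    (allocationMeasure z w m).map Prod.snd = m := by
  refine Measure.ext_of_lintegral _ fun h hh => ?_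
  rw [lintegral_map hh measurable_snd, lintegral_allocationMeasure hw (by fun_prop),
    lintegral_sum_allocation_mul hw hh]

theorem map_fst_allocationMeasure [IsFiniteMeasure m] (hw : IsAllocation w)
    (hmass : ∀ i, ∫ b, w i b ∂m = (N : ℝ)⁻¹) :
    (allocationMeasure z w m).map Prod.fst = empirical z := by
  have hlmass : ∀ i, ∫⁻ b, ENNReal.ofReal (w i b) ∂m = (N : ℝ≥0∞)⁻¹ := fun i => by
    have hN : 0 < (N : ℝ) := Nat.cast_pos.2 i.pos
    have hi : Integrable (w i) m := by
      simpa only [mul_one] using hw.integrable_mul (integrable_const (1 : ℝ)) i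
    rw [← ofReal_integral_eq_lintegral_ofReal hi (Eventually.of_forall (hw.nonneg i)),
      hmass, ENNReal.ofReal_inv_of_pos hN, ENNReal.ofReal_natCast]
  refine Measure.ext_of_lintegral _ fun h hh => ?_
  rw [lintegral_map hh measurable_fst, lintegral_allocationMeasure hw (by fun_prop),
    lintegral_empirical z hh, Finset.mul_sum]
  refine Finset.sum_congr rfl fun i _ => ?_
  dsimp only
  rw [lintegral_mul_const _ (hw.measurable i).ennreal_ofReal, hlmass]

theorem map_prodMap_allocationMeasure {A' : Type*} [MeasurableSpace A'] (hw : IsAllocation w)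
    {h : A → A'} (hh : Measurable h) :
    (allocationMeasure z w m).map (fun p => (h p.1, p.2)) = allocationMeasure (h ∘ z) w m := by
  refine Measure.ext_of_lintegral _ fun k hk => ?_
  rw [lintegral_map hk (by fun_prop), lintegral_allocationMeasure hw (by fun_prop),
    lintegral_allocationMeasure hw hk]
  rfl

theorem isProbabilityMeasure_allocationMeasure [IsProbabilityMeasure m] (hw : IsAllocation w) :
    IsProbabilityMeasure (allocationMeasure z w m) := by
  rw [← Measure.isProbabilityMeasure_map_iff measurable_snd.aemeasurable,
    map_snd_allocationMeasure hw]
  infer_instance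

end AllocationMeasure

section LipschitzFunctions

variable {X : Type*} [MetricSpace X] {φ : X → ℝ}

theorem abs_sub_le_dist_of_lipschitzWith_one (hφ : LipschitzWith 1 φ) (x y : X) :
    |φ x - φ y| ≤ dist x y := by
  simpa [Real.dist_eq] using hφ.dist_le_mul x y

variable [MeasurableSpace X] {m m₀ m₁ : Measure X}

theorem d1_nonneg : 0 ≤ d1 m₀ m₁ :=
  Real.iSup_nonneg' ⟨⟨fun _ => 0, LipschitzWith.const' 0⟩, by simp⟩

variable [BorelSpace X]

theorem HasFirstMoment.integrable_of_lipschitzWith_one [IsFiniteMeasure m]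
    (hm : HasFirstMoment m) (hφ : LipschitzWith 1 φ) : Integrable φ m := by
  obtain ⟨x₀, hx₀⟩ := hm
  refine Integrable.mono' (hx₀.add (integrable_const |φ x₀|))
    hφ.continuous.measurable.aestronglyMeasurable (Eventually.of_forall fun x => ?_)
  have hx := (abs_sub_abs_le_abs_sub _ _).trans (abs_sub_le_dist_of_lipschitzWith_one hφ x x₀)
  simpa only [Pi.add_apply, Real.norm_eq_abs] using sub_le_iff_le_add.1 hx

theorem HasFirstMoment.integrable_dist [IsFiniteMeasure m] (hm : HasFirstMoment m) (x₀ : X) :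
    Integrable (fun x => dist x₀ x) m :=
  hm.integrable_of_lipschitzWith_one (LipschitzWith.dist_right x₀)

theorem hasFirstMoment_empirical {N : ℕ} [NeZero N] (p : Fin N → X) :
    HasFirstMoment (empirical p) :=
  ⟨p 0, integrable_empirical p (by fun_prop : Measurable fun x => dist x (p 0)).stronglyMeasurable⟩

theorem abs_integral_sub_apply_le [IsProbabilityMeasure m] (hm : HasFirstMoment m)
    (hφ : LipschitzWith 1 φ) (x₀ : X) : |∫ x, φ x ∂m - φ x₀| ≤ ∫ x, dist x₀ x ∂m := by
  have hsub : ∫ x, φ x ∂m - φ x₀ = ∫ x, (φ x - φ x₀) ∂m := by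
    simp [integral_sub (hm.integrable_of_lipschitzWith_one hφ) (integrable_const _)]
  rw [hsub]
  refine (abs_integral_le_integral_abs).trans <| integral_mono_of_nonneg
    (Eventually.of_forall fun x => abs_nonneg _) (hm.integrable_dist x₀)
    (Eventually.of_forall fun x => ?_)
  simpa only [dist_comm] using abs_sub_le_dist_of_lipschitzWith_one hφ x x₀

variable [IsProbabilityMeasure m₀] [IsProbabilityMeasure m₁]

theorem bddAbove_d1 (h₀ : HasFirstMoment m₀) (h₁ : HasFirstMoment m₁) :
    BddAbove (Set.range fun φ : {φ : X → ℝ // LipschitzWith 1 φ} =>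
      (∫ x, φ.1 x ∂m₀) - ∫ x, φ.1 x ∂m₁) := by
  obtain ⟨x₀, -⟩ := id h₀
  refine ⟨∫ x, dist x₀ x ∂m₀ + ∫ x, dist x₀ x ∂m₁, Set.forall_mem_range.2 fun φ => ?_⟩
  linarith [le_abs_self (∫ x, φ.1 x ∂m₀ - φ.1 x₀), neg_abs_le (∫ x, φ.1 x ∂m₁ - φ.1 x₀),
    abs_integral_sub_apply_le h₀ φ.2 x₀, abs_integral_sub_apply_le h₁ φ.2 x₀]

theorem integral_sub_integral_le_d1 (h₀ : HasFirstMoment m₀) (h₁ : HasFirstMoment m₁)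
    (hφ : LipschitzWith 1 φ) : ∫ x, φ x ∂m₀ - ∫ x, φ x ∂m₁ ≤ d1 m₀ m₁ :=
  le_ciSup (bddAbove_d1 h₀ h₁) ⟨φ, hφ⟩

end LipschitzFunctions

section DistIntegral

variable {A X : Type*} [MeasurableSpace A] {μ : Measure A} [MetricSpace X] [MeasurableSpace X]
  [BorelSpace X] [SecondCountableTopology X] {u v : A → X}

theorem integrable_dist_of_lintegral_edist_ne_top (hu : Measurable u) (hv : Measurable v)
    (h : ∫⁻ a, edist (u a) (v a) ∂μ ≠ ⊤) : Integrable (fun a => dist (u a) (v a)) μ := by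
  refine ⟨(hu.dist hv).aestronglyMeasurable, ?_⟩
  rw [hasFiniteIntegral_iff_ofReal (Eventually.of_forall fun _ => dist_nonneg)]
  simpa only [← edist_dist] using h.lt_top

theorem integral_dist_eq_toReal_lintegral_edist (hu : Measurable u) (hv : Measurable v) :
    ∫ a, dist (u a) (v a) ∂μ = (∫⁻ a, edist (u a) (v a) ∂μ).toReal := by
  rw [integral_eq_lintegral_of_nonneg_ae (Eventually.of_forall fun _ => dist_nonneg)
    (hu.dist hv).aestronglyMeasurable]
  simp only [← edist_dist]

end DistIntegral

section Transport

variable {X : Type*} [MetricSpace X] [MeasurableSpace X] [BorelSpace X]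

section EasyInequality

variable {m₀ m₁ : Measure X}

theorem integral_sub_integral_le_of_mem_plans [IsProbabilityMeasure m₁] (h₁ : HasFirstMoment m₁)
    {φ : X → ℝ} (hφ : LipschitzWith 1 φ) {ρ : Measure (X × X)} (hρ : ρ ∈ plans m₀ m₁)
    (hdist : Integrable (fun q : X × X => dist q.1 q.2) ρ) :
    ∫ x, φ x ∂m₀ - ∫ x, φ x ∂m₁ ≤ ∫ q, dist q.1 q.2 ∂ρ := by
  obtain ⟨-, hfst, hsnd⟩ := hρ
  have hφm := hφ.continuous.measurable
  have hle (q : X × X) : |φ q.1 - φ q.2| ≤ dist q.1 q.2 :=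
    abs_sub_le_dist_of_lipschitzWith_one hφ q.1 q.2
  have hsub : Integrable (fun q : X × X => φ q.1 - φ q.2) ρ :=
    hdist.mono' (by fun_prop) (Eventually.of_forall hle)
  have hint₁ : Integrable (fun q : X × X => φ q.2) ρ := by
    have := h₁.integrable_of_lipschitzWith_one hφ
    rw [← hsnd] at this
    exact this.comp_measurable measurable_snd
  have hint₀ : Integrable (fun q : X × X => φ q.1) ρ :=
    (hsub.add hint₁).congr (Eventually.of_forall fun q => sub_add_cancel (φ q.1) (φ q.2))
  rw [← hfst, ← hsnd, integral_map (by fun_prop) hφm.aestronglyMeasurable,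
    integral_map (by fun_prop) hφm.aestronglyMeasurable, ← integral_sub hint₀ hint₁]
  exact integral_mono hsub hdist fun q => (le_abs_self _).trans (hle q)

theorem ofReal_d1_le_transportCost [SecondCountableTopology X] [IsProbabilityMeasure m₁]
    (h₁ : HasFirstMoment m₁) {ρ : Measure (X × X)} (hρ : ρ ∈ plans m₀ m₁) :
    ENNReal.ofReal (d1 m₀ m₁) ≤ transportCost ρ := by
  rcases eq_or_ne (transportCost ρ) ⊤ with htop | htop
  · simp [htop]
  have hdist := integrable_dist_of_lintegral_edist_ne_top measurable_fst measurable_snd htop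
  refine ENNReal.ofReal_le_of_le_toReal ?_
  rw [transportCost, ← integral_dist_eq_toReal_lintegral_edist measurable_fst measurable_snd]
  have : Nonempty {φ : X → ℝ // LipschitzWith 1 φ} := ⟨⟨_, LipschitzWith.const' (0 : ℝ)⟩⟩
  exact ciSup_le fun φ => integral_sub_integral_le_of_mem_plans h₁ φ.2 hρ hdist

end EasyInequality

variable {m : Measure X} {N : ℕ}

/-- An allocation `w` of `m` to the points `pᵢ` whose transport cost is at most the
Kantorovich–Rubinstein distance, hence equal to it by duality. -/
structure IsOptimalAllocation (m : Measure X) (p : Fin N → X) (w : Fin N → X → ℝ) : Prop where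
  isAllocation : IsAllocation w
  mass : ∀ i, ∫ x, w i x ∂m = (N : ℝ)⁻¹
  cost_le : ∑ i, ∫⁻ x, ENNReal.ofReal (w i x) * edist (p i) x ∂m ≤
    ENNReal.ofReal (d1 (empirical p) m)

variable [IsProbabilityMeasure m]

theorem sum_lintegral_allocation_mul_edist (hm : HasFirstMoment m) (p : Fin N → X)
    {w : Fin N → X → ℝ} (hw : IsAllocation w) :
    ∑ i, ∫⁻ x, ENNReal.ofReal (w i x) * edist (p i) x ∂m =
      ENNReal.ofReal (∑ i, ∫ x, w i x * dist (p i) x ∂m) := by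
  have hnonneg : ∀ i x, 0 ≤ w i x * dist (p i) x := fun i x =>
    mul_nonneg (hw.nonneg i x) dist_nonneg
  rw [ENNReal.ofReal_sum_of_nonneg fun i _ => integral_nonneg (hnonneg i)]
  refine Finset.sum_congr rfl fun i _ => ?_
  rw [ofReal_integral_eq_lintegral_ofReal (hw.integrable_mul (hm.integrable_dist (p i)) i)
    (Eventually.of_forall (hnonneg i))]
  exact lintegral_congr fun x => by rw [ENNReal.ofReal_mul (hw.nonneg i x), edist_dist]

theorem exists_isAllocation_cost_le_d1 [NeZero N] (hm : HasFirstMoment m) (p : Fin N → X) :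
    ∃ w : Fin N → X → ℝ, IsAllocation w ∧ (∀ i, ∫ x, w i x ∂m = (N : ℝ)⁻¹) ∧
      ∑ i, ∫ x, w i x * dist (p i) x ∂m ≤ d1 (empirical p) m := by
  refine exists_isAllocation_of_forall_partition (fun i x => dist_nonneg) (fun i => by fun_prop)
    (fun i => hm.integrable_dist (p i)) fun ψ => ?_
  obtain ⟨k, hk, hmin⟩ := exists_measurable_argmin (e := fun i x => ψ i + dist (p i) x)
    (fun i => by fun_prop)
  refine ⟨k, hk, ?_⟩
  -- The infimal convolution of `ψ` with the distance is the test function for `d1`.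
  set φ : X → ℝ := fun x => ψ (k x) + dist (p (k x)) x
  have hφ : LipschitzWith 1 φ := by
    refine LipschitzWith.of_le_add fun x y => ?_
    have htriangle := dist_triangle (p (k y)) y x
    rw [dist_comm y x] at htriangle
    linarith [hmin x (k y)]
  have hdual := integral_sub_integral_le_d1 (hasFirstMoment_empirical p) hm hφ.neg
  simp only [Pi.neg_apply, integral_neg] at hdual
  rw [integral_empirical p hφ.continuous.measurable.stronglyMeasurable, smul_eq_mul,
    Finset.mul_sum] at hdual
  have hφψ : ∑ i, (N : ℝ)⁻¹ * φ (p i) ≤ ∑ i, (N : ℝ)⁻¹ * ψ i :=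
    Finset.sum_le_sum fun i _ => mul_le_mul_of_nonneg_left
      (by simpa using hmin (p i) i) (by positivity)
  linarith

theorem exists_isOptimalAllocation [NeZero N] (hm : HasFirstMoment m) (p : Fin N → X) :
    ∃ w : Fin N → X → ℝ, IsOptimalAllocation m p w := by
  obtain ⟨w, hw, hmass, hcost⟩ := exists_isAllocation_cost_le_d1 hm p
  refine ⟨w, hw, hmass, ?_⟩
  rw [sum_lintegral_allocation_mul_edist hm p hw]
  exact ENNReal.ofReal_le_ofReal hcost

variable [SecondCountableTopology X] {p : Fin N → X}

theorem IsOptimalAllocation.transportCost_le {w : Fin N → X → ℝ}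
    (hw : IsOptimalAllocation m p w) :
    transportCost (allocationMeasure p w m) ≤ ENNReal.ofReal (d1 (empirical p) m) := by
  rw [transportCost, lintegral_allocationMeasure hw.isAllocation (by fun_prop)]
  exact hw.cost_le

theorem IsOptimalAllocation.isOptimalPlan (hm : HasFirstMoment m) {w : Fin N → X → ℝ}
    (hw : IsOptimalAllocation m p w) :
    IsOptimalPlan (empirical p) m (allocationMeasure p w m) :=
  ⟨⟨isProbabilityMeasure_allocationMeasure hw.isAllocation,
    map_fst_allocationMeasure hw.isAllocation hw.mass,
    map_snd_allocationMeasure hw.isAllocation⟩,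
    fun _ hρ' => hw.transportCost_le.trans (ofReal_d1_le_transportCost hm hρ')⟩

theorem IsOptimalPlan.transportCost_le [NeZero N] (hm : HasFirstMoment m) {ρ : Measure (X × X)}
    (hρ : IsOptimalPlan (empirical p) m ρ) :
    transportCost ρ ≤ ENNReal.ofReal (d1 (empirical p) m) := by
  obtain ⟨w, hw⟩ := exists_isOptimalAllocation hm p
  exact (hρ.2 _ (hw.isOptimalPlan hm).1).trans hw.transportCost_le

end Transport

/-! ### The bridging method -/

section Bridging

section Topology

variable {X Y H : Type*} {F : X → Set Y}

/-- The projection `(x, y) ↦ x` of the graph on its first component. -/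
def base (F : X → Set Y) (z : graph F) : X := z.1.1

theorem range_pt (x : X) : Set.range (pt F x) = base F ⁻¹' {x} := by
  ext z
  constructor
  · rintro ⟨y, rfl⟩
    rfl
  · rintro rfl
    exact ⟨⟨z.1.2, z.2⟩, rfl⟩

section Proper

variable [TopologicalSpace X] [TopologicalSpace Y]

theorem continuous_base : Continuous (base F) := by
  unfold base
  fun_prop

theorem continuous_pt (x : X) : Continuous (pt F x) := by
  unfold pt
  fun_prop

theorem isCompact_preimage_base (hc : ∀ x, IsCompact (F x)) (x : X) :
    IsCompact (base F ⁻¹' {x}) := by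
  have := isCompact_iff_compactSpace.1 (hc x)
  rw [← range_pt]
  exact isCompact_range (continuous_pt x)

theorem isProperMap_base (hF : IsClosed (graph F)) (hc : ∀ x, IsCompact (F x))
    (hu : UpperHemicontinuous F) : IsProperMap (base F) := by
  refine isProperMap_iff_isClosedMap_and_compact_fibers.2
    ⟨continuous_base, fun C hC => ?_, fun x => isCompact_preimage_base hc x⟩
  have hC' : IsClosed ((↑) '' C : Set (X × Y)) := hF.isClosedMap_subtype_val C hC
  rw [← isOpen_compl_iff, isOpen_iff_mem_nhds]
  intro x hx
  have hsub : ({x} : Set X) ×ˢ F x ⊆ ((↑) '' C : Set (X × Y))ᶜ := by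
    rintro ⟨x', y⟩ ⟨rfl, _⟩ ⟨z, hz, hzy⟩
    exact hx ⟨z, hz, congrArg Prod.fst hzy⟩
  obtain ⟨u, v, hu_open, hv_open, hxu, hFv, huv⟩ :=
    generalized_tube_lemma isCompact_singleton (hc x) hC'.isOpen_compl hsub
  have hFv_near : ∀ᶠ x' in 𝓝 x, F x' ⊆ v :=
    upperHemicontinuousAt_iff_forall_isOpen.1 (hu x) v hv_open hFv
  filter_upwards [hFv_near, hu_open.mem_nhds (hxu rfl)] with x' hx' hx'u
  rintro ⟨z, hz, rfl⟩
  exact huv (Set.mk_mem_prod hx'u (hx' z.2)) ⟨z, hz, rfl⟩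

end Proper

variable [MetricSpace X] [NormedAddCommGroup H] {g : graph F → H} {Lg : ℝ≥0}

theorem bridgeSet_nonempty (hg : SetLipschitz Lg (contributions F g)) (p : graph F × X) :
    (bridgeSet F g Lg p).Nonempty := by
  obtain ⟨_, ⟨y, rfl⟩, b, hb, hab⟩ := hg p.1.1.1 p.2 ⟨⟨p.1.1.2, p.1.2⟩, rfl⟩
  refine ⟨pt F p.2 y, rfl, ?_⟩
  rw [norm_sub_rev]
  simpa [← show g (pt F p.2 y) + b = g p.1 from hab] using hb

theorem measurableCompactValued_bridgeSet [MetricSpace Y] [MeasurableSpace X] [BorelSpace X]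
    [SecondCountableTopology X] [MeasurableSpace Y] [BorelSpace Y] [SecondCountableTopology Y]
    (hF : IsClosed (graph F)) (h₂ : Assumption2 F g Lg) :
    MeasurableCompactValued (bridgeSet F g Lg) where
  nonempty := bridgeSet_nonempty h₂.lipschitz
  isCompact p := by
    have hg := h₂.continuous
    have hclosed : IsClosed {z : graph F | ‖g z - g p.1‖ ≤ Lg * dist p.1.1.1 p.2} :=
      isClosed_le (by fun_prop) continuous_const
    exact (isCompact_preimage_base h₂.compact p.2).inter_right hclosed
  measurable_hit C hC := by
    have hg := h₂.continuous
    have hb := continuous_base (F := F)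
    have hle : IsClosed {q : graph F × graph F |
        ‖g q.2 - g q.1‖ ≤ Lg * dist (base F q.1) (base F q.2)} :=
      isClosed_le (by fun_prop) (by fun_prop)
    have himage := isProperMap_id.prodMap (isProperMap_base hF h₂.compact h₂.usc)
      |>.isClosedMap _ ((hC.preimage (continuous_snd (X := graph F))).inter hle)
    convert himage.measurableSet using 1
    ext p
    constructor
    · rintro ⟨z, ⟨hzp, hz⟩, hzC⟩
      have hzp' : base F z = p.2 := hzp
      exact ⟨(p.1, z), ⟨hzC, by rw [Set.mem_ofPred_eq, hzp']; exact hz⟩, Prod.ext rfl hzp⟩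
    · rintro ⟨⟨z₀, z⟩, ⟨hzC, hz⟩, rfl⟩
      exact ⟨z, ⟨rfl, hz⟩, hzC⟩

end Topology

section Plans

variable {A X : Type*} [MeasurableSpace A] {μ : Measure A} [IsProbabilityMeasure μ]
  [MetricSpace X] [MeasurableSpace X] [BorelSpace X] [SecondCountableTopology X] {T : A → X}

theorem IsAllocation.comp {ι B : Type*} [Fintype ι] [MeasurableSpace B] {w : ι → B → ℝ}
    (hw : IsAllocation w) {h : A → B} (hh : Measurable h) : IsAllocation fun i a => w i (h a) :=
  ⟨fun i => (hw.measurable i).comp hh, fun i a => hw.nonneg i (h a), fun a => hw.sum_eq_one (h a)⟩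

theorem exists_coupling_empirical_lintegral_edist_le_d1 (hT : Measurable T)
    (hm : HasFirstMoment (μ.map T)) {N : ℕ} [NeZero N] (x : Fin N → X) :
    ∃ ν : Measure (A × X), IsProbabilityMeasure ν ∧ ν.map Prod.fst = μ ∧
      ν.map Prod.snd = empirical x ∧
      ∫⁻ p, edist (T p.1) p.2 ∂ν ≤ ENNReal.ofReal (d1 (empirical x) (μ.map T)) := by
  have : IsProbabilityMeasure (μ.map T) := Measure.isProbabilityMeasure_map hT.aemeasurable
  obtain ⟨w, hw⟩ := exists_isOptimalAllocation hm x
  have hwT := hw.isAllocation.comp hT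
  have hmass : ∀ i, ∫ a, w i (T a) ∂μ = (N : ℝ)⁻¹ := fun i => by
    rw [← hw.mass i,
      integral_map hT.aemeasurable (hw.isAllocation.measurable i).aestronglyMeasurable]
  have := isProbabilityMeasure_allocationMeasure (z := x) (m := μ) hwT
  refine ⟨(allocationMeasure x (fun i a => w i (T a)) μ).map Prod.swap,
    Measure.isProbabilityMeasure_map measurable_swap.aemeasurable, ?_, ?_, ?_⟩
  · rw [Measure.map_map measurable_fst measurable_swap]
    exact map_snd_allocationMeasure hwT
  · rw [Measure.map_map measurable_snd measurable_swap]
    exact map_fst_allocationMeasure hwT hmass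
  · rw [lintegral_map (by fun_prop) measurable_swap,
      lintegral_allocationMeasure hwT (by fun_prop)]
    refine le_of_eq_of_le (Finset.sum_congr rfl fun i _ => ?_) hw.cost_le
    have hwm := hw.isAllocation.measurable i
    rw [lintegral_map (by fun_prop) hT]
    exact lintegral_congr fun a => by rw [Prod.fst_swap, Prod.snd_swap, edist_comm]

theorem measurable_map_allocationMeasure {Ω A B C : Type*} [MeasurableSpace Ω]
    [MeasurableSpace A] [MeasurableSpace B] [MeasurableSpace C] {N : ℕ} {z : Ω → Fin N → A}
    (hz : ∀ i, Measurable fun ω => z ω i) {w : Fin N → B → ℝ} {m : Measure B} [SFinite m]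
    {s : A × B → C} (hs : Measurable s) :
    Measurable fun ω => (allocationMeasure (z ω) w m).map s := by
  refine Measure.measurable_of_measurable_coe _ fun S hS => ?_
  simp only [Measure.map_apply hs hS, allocationMeasure, Measure.finsetSum_apply]
  refine Finset.measurable_fun_sum _ fun i _ => ?_
  simp only [Measure.dirac_prod, Measure.map_apply measurable_prodMk_left (hs hS)]
  exact (measurable_measure_prodMk_left (hs hS)).comp (hz i)

end Plans

variable {X Y H : Type*} [MetricSpace X] [MeasurableSpace X] [BorelSpace X]
  [MetricSpace Y] [MeasurableSpace Y] [BorelSpace Y] [SecondCountableTopology Y]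
  [NormedAddCommGroup H] {F : X → Set Y} {g : graph F → H} {Lg : ℝ≥0}

theorem measurable_base : Measurable (base F) := continuous_base.measurable

theorem measurable_pt_apply {Ω : Type*} [MeasurableSpace Ω] {N : ℕ} {x : Fin N → X}
    {y : Ω → (i : Fin N) → F (x i)} (hy : Measurable y) (i : Fin N) :
    Measurable fun ω => pt F (x i) (y ω i) :=
  (continuous_pt (x i)).measurable.comp ((measurable_pi_apply i).comp hy)

section Selection

variable {ν : Measure (graph F × X)} [IsProbabilityMeasure ν] {s : graph F × X → graph F}

theorem map_mem_admissible (hs : Measurable s) (hsS : ∀ p, s p ∈ bridgeSet F g Lg p) :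
    ν.map s ∈ admissible F (ν.map Prod.snd) := by
  refine ⟨Measure.isProbabilityMeasure_map hs.aemeasurable, ?_⟩
  change (ν.map s).map (base F) = _
  rw [Measure.map_map measurable_base hs]
  congr 1
  exact funext fun p => (hsS p).1

variable [SecondCountableTopology X]

theorem integrable_of_forall_norm_le (hg : Continuous g) {R : ℝ} (hR : ∀ z, ‖g z‖ ≤ R)
    (μ : Measure (graph F)) [IsFiniteMeasure μ] : Integrable g μ :=
  .of_bound hg.aestronglyMeasurable R (Eventually.of_forall hR)

theorem norm_integral_map_sub_le [NormedSpace ℝ H] (hg : Continuous g) {R : ℝ}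
    (hR : ∀ z, ‖g z‖ ≤ R) (hs : Measurable s) (hsS : ∀ p, s p ∈ bridgeSet F g Lg p) {c : ℝ}
    (hc₀ : 0 ≤ c) (hc : ∫⁻ p, edist (base F p.1) p.2 ∂ν ≤ ENNReal.ofReal c) :
    ‖∫ z, g z ∂(ν.map s) - ∫ z, g z ∂(ν.map Prod.fst)‖ ≤ Lg * c := by
  have hb : Measurable fun p : graph F × X => base F p.1 := measurable_base.comp measurable_fst
  have hdist := integrable_dist_of_lintegral_edist_ne_top hb measurable_snd
    (hc.trans_lt ENNReal.ofReal_lt_top).ne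
  have hcost : ∫ p, dist (base F p.1) p.2 ∂ν ≤ c := by
    rw [integral_dist_eq_toReal_lintegral_edist hb measurable_snd]
    exact ENNReal.toReal_le_of_le_ofReal hc₀ hc
  have hint {t : graph F × X → graph F} (ht : Measurable t) : Integrable (fun p => g (t p)) ν :=
    (integrable_of_forall_norm_le hg hR (ν.map t)).comp_measurable ht
  rw [integral_map hs.aemeasurable hg.aestronglyMeasurable,
    integral_map measurable_fst.aemeasurable hg.aestronglyMeasurable,
    ← integral_sub (hint hs) (hint measurable_fst)]
  calc ‖∫ p, (g (s p) - g p.1) ∂ν‖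
      ≤ ∫ p, Lg * dist (base F p.1) p.2 ∂ν :=
        norm_integral_le_of_norm_le (hdist.const_mul _) (Eventually.of_forall fun p => (hsS p).2)
    _ = Lg * ∫ p, dist (base F p.1) p.2 ∂ν := integral_const_mul _ _
    _ ≤ Lg * c := by gcongr

end Selection

variable [SecondCountableTopology X] {m : Measure X} [IsProbabilityMeasure m] {N : ℕ} [NeZero N]
  {x : Fin N → X}

theorem exists_measurable_isBridgingOutput [InnerProductSpace ℝ H] {Ω : Type*}
    [MeasurableSpace Ω] (hF : IsClosed (graph F))
    (h₂ : Assumption2 F g Lg) (hm : HasFirstMoment m) {y : Ω → (i : Fin N) → F (x i)}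
    (hy : Measurable y) :
    ∃ μt : Ω → Measure (graph F), Measurable μt ∧
      ∀ ω, IsBridgingOutput F g Lg (empirical x) m
        (empirical fun i => pt F (x i) (y ω i)) (μt ω) := by
  obtain ⟨w, hw⟩ := exists_isOptimalAllocation hm x
  obtain ⟨s, hs, hsS⟩ := (measurableCompactValued_bridgeSet hF h₂).exists_measurable_selection
  let ν (ω : Ω) := allocationMeasure (fun i => pt F (x i) (y ω i)) w m
  have hν (ω : Ω) : (ν ω).map (fun p => (p.1.1.1, p.2)) = allocationMeasure x w m :=
    map_prodMap_allocationMeasure hw.isAllocation measurable_base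
  exact ⟨fun ω => (ν ω).map s, measurable_map_allocationMeasure (measurable_pt_apply hy) hs,
    fun ω => ⟨allocationMeasure x w m, hw.isOptimalPlan hm, ν ω,
      isProbabilityMeasure_allocationMeasure hw.isAllocation,
      map_fst_allocationMeasure hw.isAllocation hw.mass, hν ω, s, hs, hsS, rfl⟩⟩

theorem IsBridgingOutput.mem_admissible_and_norm_sub_le [InnerProductSpace ℝ H]
    (hg : Continuous g) {R : ℝ} (hR : ∀ z, ‖g z‖ ≤ R) (hm : HasFirstMoment m)
    {μ₀ μ₁ : Measure (graph F)} (h : IsBridgingOutput F g Lg (empirical x) m μ₀ μ₁) :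
    μ₁ ∈ admissible F m ∧
      ‖∫ z, g z ∂μ₁ - ∫ z, g z ∂μ₀‖ ≤ Lg * d1 (empirical x) m := by
  obtain ⟨ρ, hρ, ν, hν, rfl, hνρ, s, hs, hsS, rfl⟩ := h
  have hpair : Measurable fun p : graph F × X => (p.1.1.1, p.2) :=
    (measurable_base.comp measurable_fst).prodMk measurable_snd
  have hsnd : ν.map Prod.snd = m := by
    rw [← hρ.1.2.2, ← hνρ, Measure.map_map measurable_snd hpair]
    rfl
  refine ⟨hsnd ▸ map_mem_admissible hs hsS,
    norm_integral_map_sub_le hg hR hs hsS d1_nonneg (le_of_eq_of_le ?_ (hρ.transportCost_le hm))⟩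
  rw [transportCost, ← hνρ, lintegral_map (by fun_prop) hpair]
  rfl

theorem exists_mem_admissible_empirical_norm_sub_le [NormedSpace ℝ H] (hF : IsClosed (graph F))
    (h₂ : Assumption2 F g Lg) {R : ℝ} (hR : ∀ z, ‖g z‖ ≤ R) (hm : HasFirstMoment m)
    (x : Fin N → X) {μ : Measure (graph F)} (hμ : μ ∈ admissible F m) :
    ∃ μ' ∈ admissible F (empirical x),
      ‖∫ z, g z ∂μ' - ∫ z, g z ∂μ‖ ≤ Lg * d1 (empirical x) m := by
  obtain ⟨hprob, hμm⟩ := hμ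
  replace hμm : μ.map (base F) = m := hμm
  subst hμm
  obtain ⟨ν, hν, hfst, hsnd, hcost⟩ :=
    exists_coupling_empirical_lintegral_edist_le_d1 measurable_base hm x
  obtain ⟨s, hs, hsS⟩ := (measurableCompactValued_bridgeSet hF h₂).exists_measurable_selection
  refine ⟨ν.map s, hsnd ▸ map_mem_admissible hs hsS, ?_⟩
  have hbound := norm_integral_map_sub_le h₂.continuous hR hs hsS d1_nonneg hcost
  rwa [hfst] at hbound

end Bridging

/-! ### Bernoulli sampling -/

section BernoulliVariable

variable {Ω : Type*}

/-- The indicator of a random Boolean. -/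
def boolIndicator (B : Ω → Bool) (ω : Ω) : ℝ := if B ω then 1 else 0

theorem boolIndicator_mul_self (B : Ω → Bool) (ω : Ω) :
    boolIndicator B ω * boolIndicator B ω = boolIndicator B ω := by
  unfold boolIndicator
  split_ifs <;> simp

theorem norm_boolIndicator_le (B : Ω → Bool) (ω : Ω) : ‖boolIndicator B ω‖ ≤ 1 := by
  unfold boolIndicator
  split_ifs <;> simp

theorem measurable_boolIndicator {mΩ : MeasurableSpace Ω} {B : Ω → Bool} (hB : Measurable B) :
    Measurable (boolIndicator B) :=
  (measurable_of_countable fun b : Bool => if b then (1 : ℝ) else 0).comp hB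

variable {𝒢 mΩ : MeasurableSpace Ω} {Pr : Measure Ω} {B : Ω → Bool} {p : unitInterval}

theorem integral_boolIndicator (hB : Measurable B)
    (hlaw : Pr.map B = bernoulliMeasure true false p) : ∫ ω, boolIndicator B ω ∂Pr = p := by
  calc ∫ ω, boolIndicator B ω ∂Pr = ∫ b, (if b then (1 : ℝ) else 0) ∂(Pr.map B) := by
        rw [integral_map hB.aemeasurable (measurable_of_countable _).aestronglyMeasurable]
        rfl
    _ = p := by simp [hlaw, integral_bernoulliMeasure]

theorem integral_boolIndicator_mul (hB : Measurable B)
    (hlaw : Pr.map B = bernoulliMeasure true false p) (h𝒢 : 𝒢 ≤ mΩ)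
    (hind : Indep (MeasurableSpace.comap B inferInstance) 𝒢 Pr) {Z : Ω → ℝ}
    (hZ : Measurable[𝒢] Z) : ∫ ω, boolIndicator B ω * Z ω ∂Pr = p * ∫ ω, Z ω ∂Pr := by
  have hindep : IndepFun (boolIndicator B) Z Pr := (IndepFun_iff_Indep _ _ _).2 <|
    indep_of_indep_of_le_left (indep_of_indep_of_le_right hind hZ.comap_le)
      (measurable_boolIndicator (comap_measurable B)).comap_le
  have hZ' : Measurable Z := hZ.mono h𝒢 le_rfl
  rw [hindep.integral_fun_mul_eq_mul_integral
    (measurable_boolIndicator hB).aestronglyMeasurable hZ'.aestronglyMeasurable,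
    integral_boolIndicator hB hlaw]

end BernoulliVariable

section SquareIntegrable

variable {Ω H : Type*} [NormedAddCommGroup H] [InnerProductSpace ℝ H] {mΩ : MeasurableSpace Ω}
  {Pr : Measure Ω}

theorem integrable_inner_of_memLp_two {u v : Ω → H} (hu : MemLp u 2 Pr) (hv : MemLp v 2 Pr) :
    Integrable (fun ω => inner ℝ (u ω) (v ω)) Pr :=
  (hu.norm.integrable_mul hv.norm).mono' (hu.1.inner hv.1)
    (Eventually.of_forall fun _ => norm_inner_le_norm _ _)

theorem integral_norm_sum_sq {ι : Type*} [Fintype ι] {v : ι → Ω → H}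
    (hv : ∀ i, MemLp (v i) 2 Pr) :
    ∫ ω, ‖∑ i, v i ω‖ ^ 2 ∂Pr = ∑ i, ∑ l, ∫ ω, inner ℝ (v i ω) (v l ω) ∂Pr := by
  have hint (i l : ι) : Integrable (fun ω => inner ℝ (v i ω) (v l ω)) Pr :=
    integrable_inner_of_memLp_two (hv i) (hv l)
  simp_rw [← real_inner_self_eq_norm_sq, sum_inner, inner_sum]
  rw [integral_finsetSum _ fun i _ => integrable_finsetSum _ fun l _ => hint i l]
  exact Finset.sum_congr rfl fun i _ => integral_finsetSum _ fun l _ => hint i l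

end SquareIntegrable

/-- Bernoulli variables `B i` of parameter `p`, simulated one after the other: each of them is
independent of the information `𝒢` available beforehand together with the preceding variables. -/
structure IsBernoulliSampling {ι Ω : Type*} [LT ι] (𝒢 : MeasurableSpace Ω)
    {mΩ : MeasurableSpace Ω} (Pr : Measure Ω) (p : unitInterval) (B : ι → Ω → Bool) : Prop where
  le : 𝒢 ≤ mΩ
  measurable : ∀ i, Measurable (B i)
  law : ∀ i, Pr.map (B i) = bernoulliMeasure true false p
  indep : ∀ i, Indep (MeasurableSpace.comap (B i) inferInstance)
    (𝒢 ⊔ ⨆ l, ⨆ _ : l < i, MeasurableSpace.comap (B l) inferInstance) Pr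

namespace IsBernoulliSampling

variable {ι Ω : Type*} [LinearOrder ι] {𝒢 mΩ : MeasurableSpace Ω} {Pr : Measure Ω}
  {p : unitInterval} {B : ι → Ω → Bool}

theorem integral_boolIndicator_mul (h : IsBernoulliSampling 𝒢 Pr p B) (i : ι) {Z : Ω → ℝ}
    (hZ : Measurable[𝒢] Z) : ∫ ω, boolIndicator (B i) ω * Z ω ∂Pr = p * ∫ ω, Z ω ∂Pr :=
  MFO.integral_boolIndicator_mul (h.measurable i) (h.law i) h.le
    (indep_of_indep_of_le_right (h.indep i) le_sup_left) hZ

theorem integral_boolIndicator_mul_mul_of_lt (h : IsBernoulliSampling 𝒢 Pr p B) {i l : ι}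
    (hil : i < l) {Z : Ω → ℝ} (hZ : Measurable[𝒢] Z) :
    ∫ ω, boolIndicator (B l) ω * (boolIndicator (B i) ω * Z ω) ∂Pr =
      (p : ℝ) ^ 2 * ∫ ω, Z ω ∂Pr := by
  set ℱ := 𝒢 ⊔ ⨆ l', ⨆ _ : l' < l, MeasurableSpace.comap (B l') inferInstance
  have hℱ : ℱ ≤ mΩ := sup_le h.le (iSup₂_le fun l' _ => (h.measurable l').comap_le)
  have hBi : Measurable[ℱ] (B i) := by
    rw [measurable_iff_comap_le]
    exact le_sup_of_le_right (le_iSup₂_of_le i hil le_rfl)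
  have hBZ : Measurable[ℱ] fun ω => boolIndicator (B i) ω * Z ω :=
    (measurable_boolIndicator hBi).mul (hZ.mono le_sup_left le_rfl)
  rw [MFO.integral_boolIndicator_mul (h.measurable l) (h.law l) hℱ (h.indep l) hBZ,
    h.integral_boolIndicator_mul i hZ]
  ring

theorem integral_boolIndicator_mul_mul (h : IsBernoulliSampling 𝒢 Pr p B) (i l : ι) {Z : Ω → ℝ}
    (hZ : Measurable[𝒢] Z) :
    ∫ ω, boolIndicator (B i) ω * (boolIndicator (B l) ω * Z ω) ∂Pr =
      ((p : ℝ) ^ 2 + if i = l then (p : ℝ) * (1 - p) else 0) * ∫ ω, Z ω ∂Pr := by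
  rcases lt_trichotomy i l with hil | rfl | hli
  · simp_rw [if_neg hil.ne, add_zero, mul_left_comm (boolIndicator (B i) _),
      h.integral_boolIndicator_mul_mul_of_lt hil hZ]
  · simp_rw [if_pos, ← mul_assoc, boolIndicator_mul_self, h.integral_boolIndicator_mul i hZ]
    ring
  · rw [if_neg hli.ne', add_zero, h.integral_boolIndicator_mul_mul_of_lt hli hZ]

variable {H : Type*} [NormedAddCommGroup H] [InnerProductSpace ℝ H] {v : ι → Ω → H}

theorem memLp_boolIndicator_smul (h : IsBernoulliSampling 𝒢 Pr p B) {i : ι} {u : Ω → H}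
    (hu : MemLp u 2 Pr) : MemLp (fun ω => boolIndicator (B i) ω • u ω) 2 Pr :=
  hu.of_le ((measurable_boolIndicator (h.measurable i)).aestronglyMeasurable.smul hu.1)
    (Eventually.of_forall fun ω => by
      simpa only [norm_smul, one_mul] using
        mul_le_mul_of_nonneg_right (norm_boolIndicator_le (B i) ω) (norm_nonneg (u ω)))

variable [Fintype ι]

theorem memLp_sum_smul (h : IsBernoulliSampling 𝒢 Pr p B) (hv : ∀ i, MemLp (v i) 2 Pr) :
    MemLp (fun ω => ∑ i, boolIndicator (B i) ω • v i ω) 2 Pr :=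
  memLp_finsetSum _ fun i _ => h.memLp_boolIndicator_smul (hv i)

theorem integral_inner_sum_smul (h : IsBernoulliSampling 𝒢 Pr p B) {lam : Ω → H}
    (hlam : StronglyMeasurable[𝒢] lam) (hlam₂ : MemLp lam 2 Pr)
    (hv : ∀ i, StronglyMeasurable[𝒢] (v i)) (hv₂ : ∀ i, MemLp (v i) 2 Pr) :
    ∫ ω, inner ℝ (lam ω) (∑ i, boolIndicator (B i) ω • v i ω) ∂Pr =
      p * ∫ ω, inner ℝ (lam ω) (∑ i, v i ω) ∂Pr := by
  simp_rw [inner_sum]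
  rw [integral_finsetSum _ fun i _ =>
      integrable_inner_of_memLp_two hlam₂ (h.memLp_boolIndicator_smul (hv₂ i)),
    integral_finsetSum _ fun i _ => integrable_inner_of_memLp_two hlam₂ (hv₂ i), Finset.mul_sum]
  simp_rw [real_inner_smul_right]
  exact Finset.sum_congr rfl fun i _ =>
    h.integral_boolIndicator_mul i (hlam.inner (hv i)).measurable

theorem integral_norm_sum_smul_sq (h : IsBernoulliSampling 𝒢 Pr p B)
    (hv : ∀ i, StronglyMeasurable[𝒢] (v i)) (hv₂ : ∀ i, MemLp (v i) 2 Pr) :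
    ∫ ω, ‖∑ i, boolIndicator (B i) ω • v i ω‖ ^ 2 ∂Pr =
      (p : ℝ) ^ 2 * ∫ ω, ‖∑ i, v i ω‖ ^ 2 ∂Pr +
        p * (1 - p) * ∑ i, ∫ ω, ‖v i ω‖ ^ 2 ∂Pr := by
  have hpair (i l : ι) : ∫ ω, inner ℝ (boolIndicator (B i) ω • v i ω)
      (boolIndicator (B l) ω • v l ω) ∂Pr =
        ((p : ℝ) ^ 2 + if i = l then (p : ℝ) * (1 - p) else 0) *
          ∫ ω, inner ℝ (v i ω) (v l ω) ∂Pr := by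
    simp_rw [real_inner_smul_left, real_inner_smul_right]
    exact h.integral_boolIndicator_mul_mul i l ((hv i).inner (hv l)).measurable
  rw [integral_norm_sum_sq fun i => h.memLp_boolIndicator_smul (hv₂ i), integral_norm_sum_sq hv₂]
  simp only [hpair, add_mul, ite_mul, zero_mul, Finset.sum_add_distrib, Finset.sum_ite_eq,
    Finset.mem_univ, if_true, Finset.mul_sum, real_inner_self_eq_norm_sq]

end IsBernoulliSampling

/-! ### The stochastic Frank–Wolfe algorithm -/

section Recursion

variable {e : ℕ → ℝ} {c : ℝ} {N K : ℕ} [NeZero N]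

/- Weighting the recursion by `k (k + 1)` makes it telescope. -/
theorem mul_add_one_mul_le_of_frankWolfe_recursion (hc : 0 ≤ c)
    (h : ∀ k < K, e (k + 1) ≤ (1 - stepSize k) * e k +
      c / 2 * ((stepSize k : ℝ) ^ 2 + stepSize k * (1 - stepSize k) / N)) :
    ∀ k ≤ K, (k : ℝ) * (k + 1) * e k ≤ c * (2 * k + k * (k - 1) / (2 * N)) := by
  have hN : (0 : ℝ) < N := Nat.cast_pos.2 (NeZero.pos N)
  intro k
  induction k with
  | zero => simp
  | succ k ih =>
    intro hk
    have hpos : (0 : ℝ) < (k + 1) * (k + 2) := by positivity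
    have hfrac : ((k : ℝ) + 1) / (k + 2) ≤ 1 := by
      rw [div_le_one (by positivity)]
      linarith
    push_cast
    calc ((k : ℝ) + 1) * (k + 1 + 1) * e (k + 1) = (k + 1) * (k + 2) * e (k + 1) := by ring
      _ ≤ (k + 1) * (k + 2) * ((1 - 2 / ((k : ℝ) + 2)) * e k + c / 2 *
            ((2 / ((k : ℝ) + 2)) ^ 2 + 2 / ((k : ℝ) + 2) * (1 - 2 / ((k : ℝ) + 2)) / N)) :=
          mul_le_mul_of_nonneg_left (h k hk) hpos.le
      _ = k * (k + 1) * e k + (k + 1) / (k + 2) * (c * (2 + k / N)) := by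
          field_simp
          ring
      _ ≤ c * (2 * k + k * (k - 1) / (2 * N)) + 1 * (c * (2 + k / N)) :=
          add_le_add (ih (Nat.le_of_succ_le hk))
            (mul_le_mul_of_nonneg_right hfrac (by positivity))
      _ = c * (2 * (k + 1) + (k + 1) * (k + 1 - 1) / (2 * N)) := by
          field_simp
          ring

theorem le_of_frankWolfe_recursion (hc : 0 ≤ c) (hK : 1 ≤ K)
    (h : ∀ k < K, e (k + 1) ≤ (1 - stepSize k) * e k +
      c / 2 * ((stepSize k : ℝ) ^ 2 + stepSize k * (1 - stepSize k) / N)) :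
    e K ≤ c * (2 / (K + 1) + 1 / (2 * N)) := by
  have hN : (0 : ℝ) < N := Nat.cast_pos.2 (NeZero.pos N)
  have : (0 : ℝ) < K := Nat.cast_pos.2 hK
  have hKK : (0 : ℝ) < K * (K + 1) := by positivity
  refine le_of_mul_le_mul_left ?_ hKK
  calc (K : ℝ) * (K + 1) * e K ≤ c * (2 * K + K * (K - 1) / (2 * N)) :=
        mul_add_one_mul_le_of_frankWolfe_recursion hc h K le_rfl
    _ ≤ c * (2 * K + K * (K + 1) / (2 * N)) := by
        gcongr
        linarith
    _ = K * (K + 1) * (c * (2 / (K + 1) + 1 / (2 * N))) := by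
        field_simp

end Recursion

namespace IsBernoulliSampling

variable {Ω H : Type*} [NormedAddCommGroup H] [InnerProductSpace ℝ H] {𝒢 mΩ : MeasurableSpace Ω}
  {Pr : Measure Ω} {p : unitInterval} {N : ℕ} {B : Fin N → Ω → Bool} {v : Fin N → Ω → H}

theorem integral_norm_average_smul_sq_le [NeZero N] [IsProbabilityMeasure Pr]
    (h : IsBernoulliSampling 𝒢 Pr p B) (hv : ∀ i, StronglyMeasurable[𝒢] (v i))
    (hv₂ : ∀ i, MemLp (v i) 2 Pr) {D : ℝ} (hD : ∀ i ω, ‖v i ω‖ ^ 2 ≤ D) :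
    ∫ ω, ‖(N : ℝ)⁻¹ • ∑ i, boolIndicator (B i) ω • v i ω‖ ^ 2 ∂Pr ≤
      D * ((p : ℝ) ^ 2 + p * (1 - p) / N) := by
  have hN : (0 : ℝ) < N := Nat.cast_pos.2 (NeZero.pos N)
  have hp : 0 ≤ (p : ℝ) * (1 - p) := mul_nonneg p.2.1 (sub_nonneg.2 p.2.2)
  have hsum (ω : Ω) : ‖∑ i, v i ω‖ ^ 2 ≤ (N : ℝ) ^ 2 * D := calc
    ‖∑ i, v i ω‖ ^ 2 ≤ (∑ i, ‖v i ω‖) ^ 2 := by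
      gcongr
      exact norm_sum_le _ _
    _ ≤ N * ∑ i, ‖v i ω‖ ^ 2 := by
      simpa using sq_sum_le_card_mul_sum_sq (s := Finset.univ) (f := fun i => ‖v i ω‖)
    _ ≤ N * ∑ _i : Fin N, D := by
      gcongr with i
      exact hD i ω
    _ = (N : ℝ) ^ 2 * D := by
      rw [Finset.sum_const, Finset.card_fin, nsmul_eq_mul]
      ring
  have hint : ∫ ω, ‖∑ i, v i ω‖ ^ 2 ∂Pr ≤ (N : ℝ) ^ 2 * D := by
    simpa using integral_mono (memLp_finsetSum _ fun i _ => hv₂ i).integrable_norm_pow'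
      (integrable_const ((N : ℝ) ^ 2 * D)) hsum
  have hinti : ∑ i, ∫ ω, ‖v i ω‖ ^ 2 ∂Pr ≤ N * D := by
    simpa using Finset.sum_le_sum fun i (_ : i ∈ Finset.univ) =>
      integral_mono (hv₂ i).integrable_norm_pow' (integrable_const D) (hD i)
  simp_rw [norm_smul, mul_pow, integral_const_mul]
  rw [h.integral_norm_sum_smul_sq hv hv₂, norm_inv, Real.norm_natCast]
  calc ((N : ℝ)⁻¹) ^ 2 * ((p : ℝ) ^ 2 * ∫ ω, ‖∑ i, v i ω‖ ^ 2 ∂Pr +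
        p * (1 - p) * ∑ i, ∫ ω, ‖v i ω‖ ^ 2 ∂Pr)
      ≤ ((N : ℝ)⁻¹) ^ 2 * ((p : ℝ) ^ 2 * ((N : ℝ) ^ 2 * D) + p * (1 - p) * (N * D)) := by
        gcongr
    _ = D * ((p : ℝ) ^ 2 + p * (1 - p) / N) := by
        field_simp

end IsBernoulliSampling

section Profile

variable {X Y H : Type*} [NormedAddCommGroup H] {F : X → Set Y} {g : graph F → H} {N : ℕ}
  {x : Fin N → X}

/-- The change of the contribution of the `i`-th agent when it switches from `y i` to `ybar i`. -/
def jump (g : graph F → H) (y ybar : (i : Fin N) → F (x i)) (i : Fin N) : H :=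
  g (pt F (x i) (ybar i)) - g (pt F (x i) (y i))

theorem constD_nonneg : 0 ≤ constD F g := Real.iSup_nonneg fun _ => sq_nonneg _

theorem norm_jump_le {R : ℝ} (hR : ∀ z, ‖g z‖ ≤ R) (y ybar : (i : Fin N) → F (x i)) (i : Fin N) :
    ‖jump g y ybar i‖ ≤ R + R :=
  (norm_sub_le _ _).trans (add_le_add (hR _) (hR _))

theorem norm_jump_sq_le_constD {R : ℝ} (hR : ∀ z, ‖g z‖ ≤ R) (y ybar : (i : Fin N) → F (x i))
    (i : Fin N) : ‖jump g y ybar i‖ ^ 2 ≤ constD F g := by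
  have hbdd : BddAbove (Set.range fun p : graph F × graph F => ‖g p.1 - g p.2‖ ^ 2) :=
    ⟨(R + R) ^ 2, Set.forall_mem_range.2 fun p => pow_le_pow_left₀ (norm_nonneg _)
      ((norm_sub_le _ _).trans (add_le_add (hR _) (hR _))) 2⟩
  exact le_ciSup hbdd (pt F (x i) (ybar i), pt F (x i) (y i))

section Average

variable [InnerProductSpace ℝ H]

theorem inv_smul_sum_jump (y ybar : (i : Fin N) → F (x i)) :
    (N : ℝ)⁻¹ • ∑ i, jump g y ybar i = aggregate F g x ybar - aggregate F g x y := by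
  simp only [jump, Finset.sum_sub_distrib, smul_sub, aggregate]

theorem aggregate_candidate (y ybar : (i : Fin N) → F (x i)) (B : Fin N → Bool) :
    aggregate F g x (candidate F x y ybar B) = aggregate F g x y +
      (N : ℝ)⁻¹ • ∑ i, (if B i then (1 : ℝ) else 0) • jump g y ybar i := by
  rw [aggregate, aggregate, ← smul_add, ← Finset.sum_add_distrib]
  congr 1
  refine Finset.sum_congr rfl fun i _ => ?_
  by_cases hBi : B i <;> simp [candidate, jump, hBi]

theorem norm_aggregate_le [NeZero N] {R : ℝ} (hR : ∀ z, ‖g z‖ ≤ R) (y : (i : Fin N) → F (x i)) :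
    ‖aggregate F g x y‖ ≤ R := by
  have hN : (0 : ℝ) < N := Nat.cast_pos.2 (NeZero.pos N)
  rw [aggregate, norm_smul, norm_inv, Real.norm_natCast, inv_mul_le_iff₀ hN]
  calc ‖∑ i, g (pt F (x i) (y i))‖ ≤ ∑ _i : Fin N, R := norm_sum_le_of_le _ fun i _ => hR _
    _ = N * R := by simp

end Average

variable [TopologicalSpace X] [TopologicalSpace Y]

theorem continuous_contribution (hg : Continuous g) (i : Fin N) :
    Continuous fun y : (i : Fin N) → F (x i) => g (pt F (x i) (y i)) :=
  hg.comp ((continuous_pt (x i)).comp (continuous_apply i))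

theorem continuous_jump (hg : Continuous g) (i : Fin N) :
    Continuous fun q : ((i : Fin N) → F (x i)) × ((i : Fin N) → F (x i)) => jump g q.1 q.2 i :=
  ((continuous_contribution hg i).comp continuous_snd).sub
    ((continuous_contribution hg i).comp continuous_fst)

theorem continuous_aggregate [InnerProductSpace ℝ H] (hg : Continuous g) :
    Continuous (aggregate F g x) :=
  (continuous_finsetSum _ fun i _ => continuous_contribution hg i).const_smul _

end Profile

section Gap

section Support

variable {X : Type*} [MeasurableSpace X] [MeasurableSingletonClass X] {N : ℕ} {x : Fin N → X}

theorem ae_empirical_mem_range (x : Fin N → X) : ∀ᵐ a ∂(empirical x), a ∈ Set.range x := by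
  have hmeas : MeasurableSet (Set.range x)ᶜ := (Set.finite_range x).measurableSet.compl
  change empirical x (Set.range x)ᶜ = 0
  rw [← lintegral_indicator_one hmeas, lintegral_empirical x (measurable_one.indicator hmeas)]
  simp

theorem inv_mul_sum_le_integral_of_map_eq_empirical [NeZero N] {Z : Type*} [MeasurableSpace Z]
    {μ : Measure Z} {T : Z → X} (hT : Measurable T) (hμ : μ.map T = empirical x) {h : Z → ℝ}
    (hh : Integrable h μ) {v : X → ℝ} (hv : ∀ z, v (T z) ≤ h z) :
    (N : ℝ)⁻¹ * ∑ i, v (x i) ≤ ∫ z, h z ∂μ := by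
  classical
  -- `v` need not be measurable, but its restriction to the finite support of `empirical x` is.
  set w : X → ℝ := (Set.range x).indicator v
  have hw : Measurable w :=
    (measurable_const (a := (0 : ℝ))).measurable_of_countable_ne <|
      (Set.finite_range x).countable.mono fun a ha => by
        by_contra hax
        exact ha (Set.indicator_of_notMem hax v).symm
  have hwint : Integrable (fun z => w (T z)) μ :=
    (hμ ▸ integrable_empirical x hw.stronglyMeasurable : Integrable w (μ.map T)).comp_measurable hT
  have hsupp : ∀ᵐ z ∂μ, T z ∈ Set.range x :=
    ae_of_ae_map hT.aemeasurable (hμ ▸ ae_empirical_mem_range x)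
  calc (N : ℝ)⁻¹ * ∑ i, v (x i) = (N : ℝ)⁻¹ * ∑ i, w (x i) := by
        simp only [w, Set.indicator_of_mem (Set.mem_range_self _)]
    _ = ∫ a, w a ∂(empirical x) := (integral_empirical x hw.stronglyMeasurable).symm
    _ = ∫ z, w (T z) ∂μ := by
        rw [← hμ, integral_map hT.aemeasurable hw.aestronglyMeasurable]
    _ ≤ ∫ z, h z ∂μ := by
        refine integral_mono_ae hwint hh ?_
        filter_upwards [hsupp] with z hz
        exact (Set.indicator_of_mem hz v).trans_le (hv z)

end Support

variable {X Y H : Type*} [MetricSpace X] [MeasurableSpace X] [BorelSpace X] [MetricSpace Y]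
  [MeasurableSpace Y] [BorelSpace Y] [SecondCountableTopology Y] [NormedAddCommGroup H]
  [InnerProductSpace ℝ H] [CompleteSpace H] {F : X → Set Y} {g : graph F → H} {N : ℕ} [NeZero N]
  {x : Fin N → X}

theorem inner_aggregate_le_inner_integral {R : ℝ} (hR : ∀ z, ‖g z‖ ≤ R) {lam : H}
    {ybar : (i : Fin N) → F (x i)} (hybar : ∀ i, ybar i ∈ BR F g lam (x i))
    {μ : Measure (graph F)} (hμ : μ ∈ admissible F (empirical x)) (hg : Integrable g μ) :
    inner ℝ lam (aggregate F g x ybar) ≤ inner ℝ lam (∫ z, g z ∂μ) := by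
  set v : X → ℝ := fun a => ⨅ y' : F a, gLin F g lam (pt F a y')
  have hbdd (a : X) : BddBelow (Set.range fun y' : F a => gLin F g lam (pt F a y')) :=
    ⟨-(‖lam‖ * R), Set.forall_mem_range.2 fun y' => (abs_le.1 <|
      (abs_real_inner_le_norm _ _).trans (mul_le_mul_of_nonneg_left (hR _) (norm_nonneg _))).1⟩
  have hvx (i : Fin N) : gLin F g lam (pt F (x i) (ybar i)) ≤ v (x i) :=
    have : Nonempty (F (x i)) := ⟨ybar i⟩
    le_ciInf (hybar i)
  have hvz (z : graph F) : v (base F z) ≤ gLin F g lam z := ciInf_le (hbdd z.1.1) ⟨z.1.2, z.2⟩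
  calc inner ℝ lam (aggregate F g x ybar)
      = (N : ℝ)⁻¹ * ∑ i, gLin F g lam (pt F (x i) (ybar i)) := by
        rw [aggregate, real_inner_smul_right, inner_sum]
        rfl
    _ ≤ (N : ℝ)⁻¹ * ∑ i, v (x i) := by
        gcongr with i
        exact hvx i
    _ ≤ ∫ z, gLin F g lam z ∂μ :=
        inv_mul_sum_le_integral_of_map_eq_empirical measurable_base hμ.2
          (hg.const_inner lam) hvz
    _ = inner ℝ lam (∫ z, g z ∂μ) := integral_inner hg lam

theorem inner_gradient_aggregate_sub_le {f : H → ℝ} (hc : ConvexOn ℝ Set.univ f)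
    (hf : Differentiable ℝ f) {R : ℝ} (hR : ∀ z, ‖g z‖ ≤ R)
    {y ybar : (i : Fin N) → F (x i)}
    (hybar : ∀ i, ybar i ∈ BR F g (gradient f (aggregate F g x y)) (x i)) {μ : Measure (graph F)}
    (hμ : μ ∈ admissible F (empirical x)) (hg : Integrable g μ) :
    inner ℝ (gradient f (aggregate F g x y)) (aggregate F g x ybar - aggregate F g x y) ≤
      f (∫ z, g z ∂μ) - f (aggregate F g x y) := by
  have hbest := inner_aggregate_le_inner_integral hR hybar hμ hg
  have hconv := add_inner_gradient_le_of_convexOn hc hf (∫ z, g z ∂μ) (aggregate F g x y)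
  rw [inner_sub_right] at hconv ⊢
  linarith

end Gap

section Descent

variable {Ω H : Type*} [NormedAddCommGroup H] [InnerProductSpace ℝ H] [CompleteSpace H]
  {𝒢 mΩ : MeasurableSpace Ω} {Pr : Measure Ω} [IsProbabilityMeasure Pr] {p : unitInterval} {N : ℕ}
  [NeZero N] {B : Fin N → Ω → Bool} {f : H → ℝ} {L : ℝ≥0} {a : Ω → H} {v : Fin N → Ω → H}

theorem IsBernoulliSampling.integral_comp_add_average_smul_le (h : IsBernoulliSampling 𝒢 Pr p B)
    (hL : LipschitzWith L (gradient f)) (hf : Differentiable ℝ f)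
    (ha : StronglyMeasurable[𝒢] a) (ha₂ : MemLp a 2 Pr) (hv : ∀ i, StronglyMeasurable[𝒢] (v i))
    (hv₂ : ∀ i, MemLp (v i) 2 Pr) {D : ℝ} (hD : ∀ i ω, ‖v i ω‖ ^ 2 ≤ D) :
    ∫ ω, f (a ω + (N : ℝ)⁻¹ • ∑ i, boolIndicator (B i) ω • v i ω) ∂Pr ≤
      ∫ ω, f (a ω) ∂Pr + p * ∫ ω, inner ℝ (gradient f (a ω)) ((N : ℝ)⁻¹ • ∑ i, v i ω) ∂Pr +
        L * D / 2 * ((p : ℝ) ^ 2 + p * (1 - p) / N) := by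
  set w : Ω → H := fun ω => (N : ℝ)⁻¹ • ∑ i, boolIndicator (B i) ω • v i ω
  have hw : MemLp w 2 Pr := (h.memLp_sum_smul hv₂).const_smul _
  have hgrad : MemLp (fun ω => gradient f (a ω)) 2 Pr := memLp_gradient_comp hL ha₂
  have hfa : Integrable (fun ω => f (a ω)) Pr := integrable_comp_of_memLp_two hL hf ha₂
  have hlin : Integrable (fun ω => inner ℝ (gradient f (a ω)) (w ω)) Pr :=
    integrable_inner_of_memLp_two hgrad hw
  have hfl : Integrable (fun ω => f (a ω) + inner ℝ (gradient f (a ω)) (w ω)) Pr := hfa.add hlin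
  have hquad : Integrable (fun ω => L / 2 * ‖w ω‖ ^ 2) Pr := hw.integrable_norm_pow'.const_mul _
  have hmean : ∫ ω, inner ℝ (gradient f (a ω)) (w ω) ∂Pr =
      p * ∫ ω, inner ℝ (gradient f (a ω)) ((N : ℝ)⁻¹ • ∑ i, v i ω) ∂Pr := by
    simp_rw [w, real_inner_smul_right, integral_const_mul]
    rw [h.integral_inner_sum_smul (hL.continuous.comp_stronglyMeasurable ha) hgrad hv hv₂,
      mul_left_comm]
  calc ∫ ω, f (a ω + w ω) ∂Pr
      ≤ ∫ ω, (f (a ω) + inner ℝ (gradient f (a ω)) (w ω) + L / 2 * ‖w ω‖ ^ 2) ∂Pr :=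
        integral_mono (integrable_comp_of_memLp_two hL hf (ha₂.add hw))
          (hfl.add hquad) fun ω => le_add_inner_gradient_add_norm_sq hL hf _ _
    _ = ∫ ω, f (a ω) ∂Pr + ∫ ω, inner ℝ (gradient f (a ω)) (w ω) ∂Pr +
          L / 2 * ∫ ω, ‖w ω‖ ^ 2 ∂Pr := by
        rw [integral_add hfl hquad, integral_add hfa hlin, integral_const_mul]
    _ ≤ ∫ ω, f (a ω) ∂Pr + p * ∫ ω, inner ℝ (gradient f (a ω)) ((N : ℝ)⁻¹ • ∑ i, v i ω) ∂Pr +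
          L / 2 * (D * ((p : ℝ) ^ 2 + p * (1 - p) / N)) := by
        rw [hmean]
        gcongr
        exact h.integral_norm_average_smul_sq_le hv hv₂ hD
    _ = _ := by ring

end Descent

section Aggregate

variable {X Y H Ω : Type*} [TopologicalSpace X] [MetricSpace Y] [MeasurableSpace Y] [BorelSpace Y]
  [SecondCountableTopology Y] [NormedAddCommGroup H] [InnerProductSpace ℝ H] {F : X → Set Y}
  {g : graph F → H} {N : ℕ} [NeZero N] {x : Fin N → X} {mΩ : MeasurableSpace Ω} {Pr : Measure Ω}
  [IsFiniteMeasure Pr]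

theorem memLp_aggregate (hg : Continuous g) {R : ℝ} (hR : ∀ z, ‖g z‖ ≤ R)
    {q : Ω → (i : Fin N) → F (x i)} (hq : Measurable q) :
    MemLp (fun ω => aggregate F g x (q ω)) 2 Pr :=
  .of_bound ((continuous_aggregate hg).stronglyMeasurable.comp_measurable hq).aestronglyMeasurable
    R (.of_forall fun _ => norm_aggregate_le hR _)

end Aggregate

namespace IsSFWRun

section Past

variable {X Y H Ω : Type*} [MeasurableSpace Y] [NormedAddCommGroup H] [InnerProductSpace ℝ H]
  [CompleteSpace H] {F : X → Set Y} {g : graph F → H} {f : H → ℝ} {N : ℕ}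
  {x : Fin N → X} {K : ℕ} {n : ℕ → ℕ} {mΩ : MeasurableSpace Ω} {Pr : Measure Ω}
  {y ybar : ℕ → Ω → (i : Fin N) → F (x i)} {P : (k : ℕ) → Fin (n k) → Fin N → Ω → Bool}

theorem comap_profile_le_past (k : ℕ) (j : Fin (n k)) (i : Fin N) :
    MeasurableSpace.comap (fun ω => (y k ω, ybar k ω)) inferInstance ≤
      past F x n y ybar P k j i := by
  rw [← measurable_iff_comap_le]
  refine Measurable.prodMk ?_ ?_ <;> rw [measurable_iff_comap_le]
  · exact le_sup_of_le_left (le_sup_of_le_left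
      (le_iSup₂_of_le (f := fun l (_ : l ≤ k) => MeasurableSpace.comap (y l) inferInstance)
        k le_rfl le_rfl))
  · exact le_sup_of_le_left (le_sup_of_le_right
      (le_iSup₂_of_le (f := fun l (_ : l ≤ k) => MeasurableSpace.comap (ybar l) inferInstance)
        k le_rfl le_rfl))

theorem comap_bernoulli_le_past (k : ℕ) (j : Fin (n k)) {i l : Fin N} (hli : l < i) :
    MeasurableSpace.comap (P k j l) inferInstance ≤ past F x n y ybar P k j i :=
  le_sup_of_le_right <| le_iSup_of_le k <| le_iSup_of_le j <| le_iSup_of_le l <|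
    le_iSup_of_le (.inr ⟨rfl, .inr ⟨rfl, hli⟩⟩) le_rfl

theorem isBernoulliSampling (hrun : IsSFWRun F g f x K n Pr y ybar P) {k : ℕ} (hk : k < K)
    (j : Fin (n k)) :
    IsBernoulliSampling (MeasurableSpace.comap (fun ω => (y k ω, ybar k ω)) inferInstance) Pr
      (stepSize k) (P k j) where
  le := ((hrun.measurable_y k hk.le).prodMk (hrun.measurable_ybar k hk)).comap_le
  measurable := hrun.measurable_P k hk j
  law := hrun.law_P k hk j
  indep i := indep_of_indep_of_le_right (hrun.indep_P k hk j i) <|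
    sup_le (comap_profile_le_past k j i) (iSup₂_le fun _ hli => comap_bernoulli_le_past k j hli)

end Past

variable {X Y H Ω : Type*} [TopologicalSpace X] [MetricSpace Y] [MeasurableSpace Y] [BorelSpace Y]
  [SecondCountableTopology Y] [NormedAddCommGroup H] [InnerProductSpace ℝ H] [CompleteSpace H]
  {F : X → Set Y} {g : graph F → H} {f : H → ℝ} {L : ℝ≥0} {N : ℕ} [NeZero N] {x : Fin N → X}
  {K : ℕ} {n : ℕ → ℕ} {mΩ : MeasurableSpace Ω} {Pr : Measure Ω} [IsProbabilityMeasure Pr]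
  {y ybar : ℕ → Ω → (i : Fin N) → F (x i)} {P : (k : ℕ) → Fin (n k) → Fin N → Ω → Bool}

theorem integral_cost_succ_le (hL : LipschitzWith L (gradient f)) (hf : Differentiable ℝ f)
    (hg : Continuous g) {R : ℝ} (hR : ∀ z, ‖g z‖ ≤ R)
    (hrun : IsSFWRun F g f x K n Pr y ybar P) {k : ℕ} (hk : k < K) :
    ∫ ω, f (aggregate F g x (y (k + 1) ω)) ∂Pr ≤ ∫ ω, f (aggregate F g x (y k ω)) ∂Pr +
      stepSize k * ∫ ω, inner ℝ (gradient f (aggregate F g x (y k ω)))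
        (aggregate F g x (ybar k ω) - aggregate F g x (y k ω)) ∂Pr +
      L * constD F g / 2 * ((stepSize k : ℝ) ^ 2 + stepSize k * (1 - stepSize k) / N) := by
  let j : Fin (n k) := ⟨0, hrun.pos_n k hk⟩
  have hB := hrun.isBernoulliSampling hk j
  have hy := hrun.measurable_y k hk.le
  have hjump (i : Fin N) : StronglyMeasurable[MeasurableSpace.comap
      (fun ω => (y k ω, ybar k ω)) inferInstance] fun ω => jump g (y k ω) (ybar k ω) i :=
    (continuous_jump hg i).stronglyMeasurable.comp_measurable (comap_measurable _)
  have hagg : StronglyMeasurable[MeasurableSpace.comap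
      (fun ω => (y k ω, ybar k ω)) inferInstance] fun ω => aggregate F g x (y k ω) :=
    ((continuous_aggregate hg).comp continuous_fst).stronglyMeasurable.comp_measurable
      (comap_measurable fun ω => (y k ω, ybar k ω))
  have hjump₂ (i : Fin N) : MemLp (fun ω => jump g (y k ω) (ybar k ω) i) 2 Pr :=
    .of_bound ((hjump i).mono hB.le).aestronglyMeasurable _
      (.of_forall fun _ => norm_jump_le hR _ _ i)
  have hagg₂ := memLp_aggregate (Pr := Pr) hg hR hy
  have hsampled : MemLp (fun ω => aggregate F g x (y k ω) +
      (N : ℝ)⁻¹ • ∑ i, boolIndicator (P k j i) ω • jump g (y k ω) (ybar k ω) i) 2 Pr :=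
    hagg₂.add ((hB.memLp_sum_smul hjump₂).const_smul _)
  calc ∫ ω, f (aggregate F g x (y (k + 1) ω)) ∂Pr
      ≤ ∫ ω, f (aggregate F g x (y k ω) + (N : ℝ)⁻¹ • ∑ i,
          boolIndicator (P k j i) ω • jump g (y k ω) (ybar k ω) i) ∂Pr := by
        refine integral_mono (integrable_comp_of_memLp_two hL hf
          (memLp_aggregate hg hR (hrun.measurable_y (k + 1) hk)))
          (integrable_comp_of_memLp_two hL hf hsampled) fun ω => ?_
        exact (hrun.update_min k hk ω j).trans_eq (congrArg f (aggregate_candidate _ _ _))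
    _ ≤ _ := by
        simpa only [inv_smul_sum_jump] using hB.integral_comp_add_average_smul_le hL hf hagg hagg₂
          hjump hjump₂ fun i ω => norm_jump_sq_le_constD hR _ _ i

end IsSFWRun

section Convergence

variable {X Y H Ω : Type*} [MetricSpace X] [MeasurableSpace X] [BorelSpace X]
  [SecondCountableTopology X] [MetricSpace Y] [MeasurableSpace Y] [BorelSpace Y]
  [SecondCountableTopology Y] [NormedAddCommGroup H] [InnerProductSpace ℝ H] [CompleteSpace H]
  {F : X → Set Y} {g : graph F → H} {f : H → ℝ} {L : ℝ≥0} {N : ℕ} [NeZero N] {x : Fin N → X}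
  {K : ℕ} {n : ℕ → ℕ} {mΩ : MeasurableSpace Ω} {Pr : Measure Ω} [IsProbabilityMeasure Pr]
  {y ybar : ℕ → Ω → (i : Fin N) → F (x i)} {P : (k : ℕ) → Fin (n k) → Fin N → Ω → Bool}

theorem IsSFWRun.integral_inner_gradient_le (hc : ConvexOn ℝ Set.univ f)
    (hL : LipschitzWith L (gradient f)) (hf : Differentiable ℝ f) (hg : Continuous g) {R : ℝ}
    (hR : ∀ z, ‖g z‖ ≤ R) (hrun : IsSFWRun F g f x K n Pr y ybar P) {k : ℕ} (hk : k < K)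
    {μ : Measure (graph F)} (hμ : μ ∈ admissible F (empirical x)) :
    ∫ ω, inner ℝ (gradient f (aggregate F g x (y k ω)))
        (aggregate F g x (ybar k ω) - aggregate F g x (y k ω)) ∂Pr ≤
      f (∫ z, g z ∂μ) - ∫ ω, f (aggregate F g x (y k ω)) ∂Pr := by
  have := hμ.1
  have hy := memLp_aggregate (Pr := Pr) hg hR (hrun.measurable_y k hk.le)
  have hybar := memLp_aggregate (Pr := Pr) hg hR (hrun.measurable_ybar k hk)
  have hcost := integrable_comp_of_memLp_two hL hf hy
  calc ∫ ω, inner ℝ (gradient f (aggregate F g x (y k ω)))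
        (aggregate F g x (ybar k ω) - aggregate F g x (y k ω)) ∂Pr
      ≤ ∫ ω, (f (∫ z, g z ∂μ) - f (aggregate F g x (y k ω))) ∂Pr :=
        integral_mono (integrable_inner_of_memLp_two (memLp_gradient_comp hL hy) (hybar.sub hy))
          ((integrable_const _).sub hcost) fun ω =>
            inner_gradient_aggregate_sub_le hc hf hR (hrun.best_response k hk ω) hμ
              (integrable_of_forall_norm_le hg hR μ)
    _ = f (∫ z, g z ∂μ) - ∫ ω, f (aggregate F g x (y k ω)) ∂Pr := by
        simp [integral_sub (integrable_const _) hcost]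

theorem IsSFWRun.integral_cost_le (hc : ConvexOn ℝ Set.univ f)
    (hL : LipschitzWith L (gradient f)) (hf : Differentiable ℝ f) (hg : Continuous g) {R : ℝ}
    (hR : ∀ z, ‖g z‖ ≤ R) (hrun : IsSFWRun F g f x K n Pr y ybar P) (hK : 1 ≤ K)
    {μ : Measure (graph F)} (hμ : μ ∈ admissible F (empirical x)) :
    ∫ ω, f (aggregate F g x (y K ω)) ∂Pr ≤
      f (∫ z, g z ∂μ) + L * constD F g * (2 / (K + 1) + 1 / (2 * N)) := by
  rw [← sub_le_iff_le_add']
  refine le_of_frankWolfe_recursion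
    (e := fun k => ∫ ω, f (aggregate F g x (y k ω)) ∂Pr - f (∫ z, g z ∂μ))
    (mul_nonneg L.coe_nonneg constD_nonneg) hK fun k hk => ?_
  have hdescent := hrun.integral_cost_succ_le hL hf hg hR hk
  have hgap := mul_le_mul_of_nonneg_left (hrun.integral_inner_gradient_le hc hL hf hg hR hk hμ)
    (stepSize k).2.1
  linarith

end Convergence

/-! ### Comparison of the costs -/

section Cost

variable {X Y H : Type*} [MeasurableSpace X] [MeasurableSpace Y] [NormedAddCommGroup H]
  [InnerProductSpace ℝ H] [CompleteSpace H] {F : X → Set Y} {g : graph F → H} {f : H → ℝ}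
  {L : ℝ≥0} {R : ℝ}

theorem norm_gradient_integral_le_constC (hL : LipschitzWith L (gradient f))
    (hR : ∀ z, ‖g z‖ ≤ R) (μ : Measure (graph F)) [hμ : IsProbabilityMeasure μ] :
    ‖gradient f (∫ z, g z ∂μ)‖ ≤ constC F g f := by
  have hbdd : BddAbove (Set.range fun μ : ProbabilityMeasure (graph F) =>
      ‖gradient f (∫ z, g z ∂(μ : Measure (graph F)))‖) := by
    refine ⟨‖gradient f 0‖ + L * R, Set.forall_mem_range.2 fun μ =>
      norm_gradient_le_of_norm_le hL ?_⟩
    simpa using norm_integral_le_of_norm_le_const (μ := (μ : Measure (graph F))) (.of_forall hR)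
  exact le_ciSup hbdd ⟨μ, hμ⟩

theorem cost_le_add_constC_mul (hc : ConvexOn ℝ Set.univ f) (hL : LipschitzWith L (gradient f))
    (hf : Differentiable ℝ f) (hR : ∀ z, ‖g z‖ ≤ R) (μ : Measure (graph F))
    [IsProbabilityMeasure μ] {a : H} {r : ℝ} (hr : ‖∫ z, g z ∂μ - a‖ ≤ r) :
    f (∫ z, g z ∂μ) ≤ f a + constC F g f * r := by
  have hgrad := norm_gradient_integral_le_constC hL hR μ
  have hconv := add_inner_gradient_le_of_convexOn hc hf a (∫ z, g z ∂μ)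
  have hinner : inner ℝ (gradient f (∫ z, g z ∂μ)) (∫ z, g z ∂μ - a) ≤ constC F g f * r :=
    (real_inner_le_norm _ _).trans
      (mul_le_mul hgrad hr (norm_nonneg _) ((norm_nonneg _).trans hgrad))
  rw [← neg_sub (∫ z, g z ∂μ) a, inner_neg_right] at hconv
  linarith

end Cost

section RandomMeasure

variable {X Y H Ω : Type*} [MetricSpace X] [MeasurableSpace X] [BorelSpace X]
  [SecondCountableTopology X] [MetricSpace Y] [MeasurableSpace Y] [BorelSpace Y]
  [SecondCountableTopology Y] [NormedAddCommGroup H] [InnerProductSpace ℝ H] [CompleteSpace H]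
  {F : X → Set Y} {g : graph F → H} {f : H → ℝ} {L Lg : ℝ≥0} {R : ℝ}

theorem integrable_cost_of_measurable [MeasurableSpace Ω] {Pr : Measure Ω} [IsFiniteMeasure Pr]
    (hL : LipschitzWith L (gradient f)) (hf : Differentiable ℝ f) (hg : Continuous g)
    (hR : ∀ z, ‖g z‖ ≤ R) {μt : Ω → Measure (graph F)} (hμt : Measurable μt)
    (hprob : ∀ ω, IsProbabilityMeasure (μt ω)) :
    Integrable (fun ω => f (∫ z, g z ∂(μt ω))) Pr := by
  let κ : Kernel Ω (graph F) := ⟨μt, hμt⟩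
  have : IsMarkovKernel κ := ⟨hprob⟩
  have hmeas : StronglyMeasurable fun ω => ∫ z, g z ∂(κ ω) := hg.stronglyMeasurable.integral_kernel
  refine integrable_comp_of_memLp_two hL hf
    (.of_bound hmeas.aestronglyMeasurable R (.of_forall fun ω => ?_))
  simpa [κ] using norm_integral_le_of_norm_le_const (μ := κ ω) (.of_forall hR)

variable {N : ℕ} {x : Fin N → X}

theorem integral_empirical_pt (hg : Continuous g) (y : (i : Fin N) → F (x i)) :
    ∫ z, g z ∂(empirical fun i => pt F (x i) (y i)) = aggregate F g x y :=
  integral_empirical _ hg.stronglyMeasurable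

variable [NeZero N]

theorem integral_cost_le_integral_cost_aggregate_add [MeasurableSpace Ω] {Pr : Measure Ω}
    [IsProbabilityMeasure Pr] (hc : ConvexOn ℝ Set.univ f) (hL : LipschitzWith L (gradient f))
    (hf : Differentiable ℝ f) (hg : Continuous g) (hR : ∀ z, ‖g z‖ ≤ R)
    {μt : Ω → Measure (graph F)} (hμt : Measurable μt)
    (hprob : ∀ ω, IsProbabilityMeasure (μt ω)) {y : Ω → (i : Fin N) → F (x i)}
    (hy : Measurable y) {r : ℝ} (hr : ∀ ω, ‖∫ z, g z ∂(μt ω) - aggregate F g x (y ω)‖ ≤ r) :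
    ∫ ω, f (∫ z, g z ∂(μt ω)) ∂Pr ≤ ∫ ω, f (aggregate F g x (y ω)) ∂Pr + constC F g f * r := by
  have hcost : Integrable (fun ω => f (aggregate F g x (y ω))) Pr :=
    integrable_comp_of_memLp_two hL hf (memLp_aggregate hg hR hy)
  calc ∫ ω, f (∫ z, g z ∂(μt ω)) ∂Pr
      ≤ ∫ ω, (f (aggregate F g x (y ω)) + constC F g f * r) ∂Pr :=
        integral_mono (integrable_cost_of_measurable hL hf hg hR hμt hprob)
          (hcost.add (integrable_const _)) fun ω =>
            cost_le_add_constC_mul hc hL hf hR (μt ω) (hr ω)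
    _ = ∫ ω, f (aggregate F g x (y ω)) ∂Pr + constC F g f * r := by
        simp [integral_add hcost (integrable_const _)]

theorem sub_val_le (hc : ConvexOn ℝ Set.univ f) (hL : LipschitzWith L (gradient f))
    (hf : Differentiable ℝ f) (hF : IsClosed (graph F)) (h₂ : Assumption2 F g Lg)
    (hR : ∀ z, ‖g z‖ ≤ R) {m : Measure X} [IsProbabilityMeasure m] (hm : HasFirstMoment m)
    (hne : (admissible F m).Nonempty) {a b : ℝ}
    (hab : ∀ μ ∈ admissible F (empirical x), a ≤ f (∫ z, g z ∂μ) + b) :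
    a - val F g f m ≤ b + constC F g f * (Lg * d1 (empirical x) m) := by
  have : Nonempty (admissible F m) := hne.to_subtype
  rw [sub_le_comm]
  refine le_ciInf fun μ => ?_
  obtain ⟨μ', hμ', hclose⟩ := exists_mem_admissible_empirical_norm_sub_le hF h₂ hR hm x μ.2
  have := hμ'.1
  linarith [hab μ' hμ', cost_le_add_constC_mul hc hL hf hR μ' hclose]

end RandomMeasure

theorem frankWolfe_bound_add_bridging_bound_le {K N : ℕ} (hK : 1 ≤ K) (hKN : K ≤ 2 * N)
    {L D Lg C M d : ℝ} (hL : 0 ≤ L) (hD : 0 ≤ D) (hLg : 0 ≤ Lg) (hM : 0 ≤ M) (hd : 0 ≤ d) :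
    L * D * (2 / (K + 1) + 1 / (2 * N)) + 2 * Lg * C * d ≤
      4 * L * D / K + 2 * Lg * (C + L * M) * d := by
  have : (0 : ℝ) < K := by exact_mod_cast hK
  have hKN' : (K : ℝ) ≤ 2 * N := by exact_mod_cast hKN
  have hrate : 2 / ((K : ℝ) + 1) + 1 / (2 * N) ≤ 4 / K := calc
    2 / ((K : ℝ) + 1) + 1 / (2 * N) ≤ 2 / K + 1 / K := by
      gcongr
      exact le_add_of_nonneg_right zero_le_one
    _ ≤ 4 / K := by
      rw [← add_div]
      gcongr
      norm_num
  calc L * D * (2 / (K + 1) + 1 / (2 * N)) + 2 * Lg * C * d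
      ≤ L * D * (4 / K) + 2 * Lg * (C + L * M) * d := by
        gcongr
        exact le_add_of_nonneg_right (mul_nonneg hL hM)
    _ = 4 * L * D / K + 2 * Lg * (C + L * M) * d := by ring

end MFO

end

theorem theorem6p1_general {X Y H Ω : Type*}
    [MetricSpace X] [MeasurableSpace X] [BorelSpace X] [SecondCountableTopology X]
    [MetricSpace Y] [MeasurableSpace Y] [BorelSpace Y] [SecondCountableTopology Y]
    [NormedAddCommGroup H] [InnerProductSpace ℝ H] [CompleteSpace H]
    {F : X → Set Y} (hF : IsClosed (MFO.graph F)) {g : MFO.graph F → H} {f : H → ℝ} {L Lg : ℝ≥0}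
    {R : ℝ} (hR : ∀ z, ‖g z‖ ≤ R) (hc : ConvexOn ℝ Set.univ f) (hf : Differentiable ℝ f)
    (hL : LipschitzWith L (gradient f)) (h₂ : MFO.Assumption2 F g Lg)
    {m : Measure X} [IsProbabilityMeasure m] (hm : MFO.HasFirstMoment m)
    {N : ℕ} [NeZero N] {x : Fin N → X} {K : ℕ} (hK : 1 ≤ K) {n : ℕ → ℕ}
    [MeasurableSpace Ω] {Pr : Measure Ω} [IsProbabilityMeasure Pr]
    {y ybar : ℕ → Ω → (i : Fin N) → F (x i)}
    {P : (k : ℕ) → Fin (n k) → Fin N → Ω → Bool}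
    (hrun : MFO.IsSFWRun F g f x K n Pr y ybar P) :
    (∃ μt : Ω → Measure (MFO.graph F), Measurable μt ∧
      ∀ ω, MFO.IsBridgingOutput F g Lg (MFO.empirical x) m
        (MFO.empirical fun i => MFO.pt F (x i) (y K ω i)) (μt ω)) ∧
    ∀ μt : Ω → Measure (MFO.graph F), Measurable μt →
      (∀ ω, MFO.IsBridgingOutput F g Lg (MFO.empirical x) m
        (MFO.empirical fun i => MFO.pt F (x i) (y K ω i)) (μt ω)) →
      (∀ ω, μt ω ∈ MFO.admissible F m) ∧
      Integrable (fun ω => f (∫ z, g z ∂(μt ω))) Pr ∧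
      (∫ ω, f (∫ z, g z ∂(μt ω)) ∂Pr) - MFO.val F g f m ≤
        L * MFO.constD F g * (2 / (K + 1) + 1 / (2 * N)) +
          2 * Lg * MFO.constC F g f * MFO.d1 (MFO.empirical x) m := by
  have hg := h₂.continuous
  have hy := hrun.measurable_y K le_rfl
  refine ⟨MFO.exists_measurable_isBridgingOutput hF h₂ hm hy, fun μt hμt hout => ?_⟩
  have hbridge (ω : Ω) := (hout ω).mem_admissible_and_norm_sub_le hg hR hm
  have hprob (ω : Ω) : IsProbabilityMeasure (μt ω) := (hbridge ω).1.1
  have hclose (ω : Ω) : ‖∫ z, g z ∂(μt ω) - MFO.aggregate F g x (y K ω)‖ ≤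
      Lg * MFO.d1 (MFO.empirical x) m :=
    MFO.integral_empirical_pt hg (y K ω) ▸ (hbridge ω).2
  refine ⟨fun ω => (hbridge ω).1,
    MFO.integrable_cost_of_measurable hL hf hg hR hμt hprob, ?_⟩
  have hcost := MFO.integral_cost_le_integral_cost_aggregate_add (Pr := Pr) hc hL hf hg hR hμt
    hprob hy hclose
  obtain ⟨ω₀⟩ := nonempty_of_isProbabilityMeasure Pr
  have hval := MFO.sub_val_le hc hL hf hF h₂ hR hm ⟨μt ω₀, (hbridge ω₀).1⟩ fun _ hμ =>
    hrun.integral_cost_le hc hL hf hg hR hK hμ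
  linarith

theorem theorem6p1
    {E Y H Ω : Type*}
    [NormedAddCommGroup E] [NormedSpace ℝ E] [CompleteSpace E]
    [TopologicalSpace.SeparableSpace E] [MeasurableSpace E] [BorelSpace E]
    [MetricSpace Y] [CompleteSpace Y] [TopologicalSpace.SeparableSpace Y]
    [MeasurableSpace Y] [BorelSpace Y]
    [NormedAddCommGroup H] [InnerProductSpace ℝ H] [CompleteSpace H]
    [TopologicalSpace.SeparableSpace H]
    -- the data of the problem
    (X : Set E) (hX : IsClosed X)
    (F : X → Set Y) (hF : MFO.IsData F)
    (g : MFO.graph F → H) (f : H → ℝ) (L Lg : ℝ≥0)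
    (h₁ : MFO.Assumption1 F g f L) (h₂ : MFO.Assumption2 F g Lg)
    (m : Measure X) [IsProbabilityMeasure m] (hm : MFO.HasFirstMoment m)
    -- the discretization, and a run of the stochastic Frank–Wolfe algorithm
    (N : ℕ) (x : Fin N → X) (K : ℕ) (hK : 1 ≤ K) (hKN : K ≤ 2 * N) (n : ℕ → ℕ)
    [MeasurableSpace Ω] (Pr : Measure Ω) [IsProbabilityMeasure Pr]
    (y ybar : ℕ → Ω → (i : Fin N) → F (x i))
    (P : (k : ℕ) → Fin (n k) → Fin N → Ω → Bool)
    (hrun : MFO.IsSFWRun F g f x K n Pr y ybar P) :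
    -- the bridging method can be carried out
    (∃ μt : Ω → Measure (MFO.graph F), Measurable μt ∧
      ∀ ω, MFO.IsBridgingOutput F g Lg (MFO.empirical x) m
        (MFO.empirical fun i => MFO.pt F (x i) (y K ω i)) (μt ω)) ∧
    -- and each of its (random) outputs is admissible and satisfies the estimate
    ∀ μt : Ω → Measure (MFO.graph F), Measurable μt →
      (∀ ω, MFO.IsBridgingOutput F g Lg (MFO.empirical x) m
        (MFO.empirical fun i => MFO.pt F (x i) (y K ω i)) (μt ω)) →
      (∀ ω, μt ω ∈ MFO.admissible F m) ∧
      Integrable (fun ω => f (∫ z, g z ∂(μt ω))) Pr ∧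
      (∫ ω, f (∫ z, g z ∂(μt ω)) ∂Pr) - MFO.val F g f m ≤
        4 * L * MFO.constD F g / K +
          2 * Lg * (MFO.constC F g f + L * MFO.constM F g) * MFO.d1 (MFO.empirical x) m := by
  have : NeZero N := ⟨by omega⟩
  have : SecondCountableTopology E := UniformSpace.secondCountable_of_separable E
  have : SecondCountableTopology Y := UniformSpace.secondCountable_of_separable Y
  obtain ⟨R, hR⟩ := h₁.bounded
  obtain ⟨hex, hout⟩ := theorem6p1_general hF.closed_graph hR h₁.convex h₁.differentiable
    h₁.lipschitz_gradient h₂ hm hK hrun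
  refine ⟨hex, fun μt hμt hbridge => ?_⟩
  obtain ⟨hadm, hint, hle⟩ := hout μt hμt hbridge
  exact ⟨hadm, hint, hle.trans <| MFO.frankWolfe_bound_add_bridging_bound_le hK hKN L.coe_nonneg
    MFO.constD_nonneg Lg.coe_nonneg (Real.iSup_nonneg fun _ => norm_nonneg _) MFO.d1_nonneg⟩
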